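/- **Setting.** Let $V$ be a finite set of nodes with capacities $c(v)>0$ and hash values $h(v)\in[0,1)$, and let the data elements $d\in D$ have hash values $g(d)\in[0,1)$; the capacities are pairwise distinct, the $h(v)$ are pairwise distinct, and $g(d)\neq h(v)$ always. Let $f$ be strictly increasing on $[0,1)$ with $f(0)\ge 0$ (for example $f(t)=t$ or $f(t)=-\log(1-t)$), $C_u(x)=\frac1{c(u)}f(|x-h(u)|)$, and $R(u)=\{x\in[0,1): C_u(x)=\min_{v\in V}C_v(x)\}$. Node $u$ is responsible for $d$ if $g(d)\in R(u)$. Assume that no data element has two responsible nodes. Let $succ^+_1(u)$ (resp. $pred^+_1(u)$) be the node closest to $u$ among those with larger (resp. smaller) hash value and larger capacity than $u$; let $S^+(u)$ (resp. $P^+(u)$) be the set of its iterates from $u$; let $S^-(u)=\{v:pred^+_1(v)=u\}$ and $P^-(u)=\{v: succ^+_1(v)=u\}$. The graph $G^{CONE}$ has an edge $(u,v)$ iff $v\in S^+(u)\cup P^+(u)\cup S^-(u)\cup P^-(u)$. **States.** Each node $u$ stores lists $u.S^+,u.P^+,u.S^-,u.P^-$ of nodes, with union $N_u$, and a finite data set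 $u.DS$ of entries (interval, reference to a node, finite set of data elements). For each pair $(v,u)$ there is an unbounded FIFO channel of messages from $v$ to $u$. The explicit graph $G_e$ has an edge $(u,v)$ iff $v\in N_u$ (the references in $u.DS$ are not counted). The lists of $u$ are valid if $u.S^+$ (resp. $u.S^-$) is the set of all $v\in N_u$ with $h(v)>h(u)$ and $c(v)>c(u)$ (resp. $c(v)<c(u)$) such that $c(w)<c(v)$ for all $w\in N_u$ with $h(u)<h(w)<h(v)$, and symmetrically for $u.P^\pm$. Write $u.succ^+_1$, $u.pred^+_1$ for the closest elements of $u.S^+$, $u.P^+$, and put $u.S^*=u.S^-\cup\{u.succ^+_1\}$, $u.P^*=u.P^-\cup\{u.pred^+_1\}$, with closest elements $u.S^*[1]$, $u.P^*[1]$. The supervised interval is $I_u=[h(u),h(u.S^*[1]))$, extended to the end of $[0,1)$ if $u.S^*=\emptyset$ and to its beginning if $u.P^*=\emptyset$. Let $I_u(x)$ be the set of $y\in I_u$ with $C_x(y)\le C_v(y)$ for all $v\in N_u\cup\{u\}$. **Protocol.** *Delegating* a node $w$ on the right of $u$ means sending (build-triangle, $w$) to the rightmost element of $u.S^*$ on the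 left of $w$, if there is one; the left side is symmetric. *Periodic action of $u$.* $u$ makes its lists valid (relative to its $N_u$) and delegates the nodes dropped; sends (list-update, $u.P^+\cup\{u\}$) to all $w\in u.S^-$ and (list-update, $u.S^+\cup\{u\}$) to all $w\in u.P^-$; introduces, by build-triangle messages, each $w\in u.S^-$ and its predecessor in $u.S^*$ to each other, symmetrically on the left, $u$ to all nodes of $u.S^*\cup u.P^*$, and $u.succ^+_1$ and $u.pred^+_1$ to each other; and for each entry $(J,r)$ of $u.DS$ it sends (check-interval, $J$, $u$) to $r$. *On receiving a message $u$ acts as follows.* - (build-triangle, $x$): if $c(x)>c(u)$ and $x$ lies strictly between $u$ and $u.succ^+_1$ (if the latter does not exist: on the right of $u$), $u$ sends (build-triangle, $u.succ^+_1$) to $x$ and puts $x$ into $u.S^+$; similarly on the left. Otherwise $u$ recomputes $u.S^-$ (or $u.P^-$, according to the side of $x$) with the candidate $x$ and delegates the nodes not stored in it. - (list-update, $L$): $u$ recomputes its four lists with the candidates from $L$. When $u.S^+$ changes, its old elements not in $L$ and all the nodes rejected for it are sent by build-triangle messages to the closest element of the new $u.S^+$; likewise for $u.P^+$. The nodes rejected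 for $u.S^-$ and $u.P^-$ are delegated. - (check-interval, $J$, $x$): if $x\notin u.P^+\cup u.S^+\cup u.S^-$, $u$ processes $x$ as in build-triangle. Then it sends (update-interval, $I$) to $x$, where $I$ is a set of intervals with references: the part of $J$ on the left of $h(u)$ with reference $u.P^*[1]$ (if that node exists), the part of $J$ from $h(u.S^*[1])$ on with reference $u.S^*[1]$ (if that node exists), and the maximal intervals in $(J\cap I_u)\setminus I_u(x)$ with reference $u$. - (update-interval, $I$): the intervals of $I$ are removed from the intervals in $u.DS$, whose remaining subintervals keep their references and their data; each data element stored in an interval of $I$ is deleted and sent in a forward-data message to the reference of such an interval; intervals without data are deleted and consecutive intervals with the same reference united. The references in $I$ and the references no longer occurring in $u.DS$ are processed as in build-triangle. - (forward-data, $d$): if $g(d)\in I_u$, $u$ sends (store-data, $d$, $J$, $u$) to a node $v\in N_u\cup\{u\}$ with $g(d)\in I_u(v)$, where $J$ is the maximal interval around $g(d)$ in $I_u(v)$. Otherwise it sends (forward-data, $d$) to $u.P^*[1]$ if $g(d)$ lies between that node and $u$, and else to the node of $u.P^*\cup u.S^*$ closest to $g(d)$ among those strictly between $u$ and $g(d)$.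 - (store-data, $d$, $J$, $x$): $u$ adds $d$ to the entry with interval $J$ if there is one, sets its reference to $x$ and processes the old reference as in build-triangle; otherwise it creates the entry $(J,x,\{d\})$. **Computations.** A computation is an infinite sequence of states in which each state arises from the previous one by one atomic action: the periodic action of some node, or the receipt of the oldest message of some nonempty channel. Each node executes its periodic action infinitely often, and each message is eventually received. **Theorem.** Suppose that at time $t_0$ of a computation all lists are valid and $G_e=G^{CONE}$, while the data sets and the channels are arbitrary, except that each data element recorded for an interval, in a data set or in a store-data message, has its hash value in this interval. Then there is a time $t_1\ge t_0$ such that at all times $t\ge t_1$ each node $u$ stores exactly those data elements $d$ with $g(d)\in R(u)$ that were present in the system at time $t_0$ (stored at some node or contained in a forward-data or store-data message). -/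

import Mathlib

namespace ConeDHT

open Classical

noncomputable section

/-- The static data of a heterogeneous storage system with hosts `V` and data elements `D`:
hash values `h` of the hosts, capacities `c`, hash values `g` of the data elements, and the
increasing function `f` that shapes the capacity functions (`f t = t` is the linear and
`f t = -log (1 - t)` the logarithmic case).  All hash values and capacities are distinct. -/
structure System (V D : Type*) where
  h : V → ℝ
  c : V → ℝ
  f : ℝ → ℝ
  g : D → ℝ
  h_mem : ∀ v, h v ∈ Set.Ico (0 : ℝ) 1
  h_inj : Function.Injective h
  c_pos : ∀ v, 0 < c v
  c_inj : Function.Injective c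
  f_strictMono : StrictMonoOn f (Set.Ico (0 : ℝ) 1)
  f_zero_nonneg : 0 ≤ f 0
  g_mem : ∀ d, g d ∈ Set.Ico (0 : ℝ) 1
  g_ne_h : ∀ d v, g d ≠ h v

/-! ### Cone hashing -/

section Cone

variable {V D : Type*} (P : System V D)

/-- The capacity function `C_u`. -/
def System.C (u : V) (x : ℝ) : ℝ := 1 / P.c u * P.f |x - P.h u|

/-- The responsibility range `R(u)`. -/
def System.R (u : V) : Set ℝ := {x | x ∈ Set.Ico (0 : ℝ) 1 ∧ ∀ v, P.C u x ≤ P.C v x}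

/-- `v` is the first larger successor of `u`. -/
def System.IsSucc (u v : V) : Prop :=
  P.h u < P.h v ∧ P.c u < P.c v ∧ ∀ w, P.h u < P.h w → P.c u < P.c w → P.h v ≤ P.h w

/-- `v` is the first larger predecessor of `u`. -/
def System.IsPred (u v : V) : Prop :=
  P.h v < P.h u ∧ P.c u < P.c v ∧ ∀ w, P.h w < P.h u → P.c u < P.c w → P.h w ≤ P.h v

/-- `S⁺(u)`: the first larger successor of `u`, its first larger successor, and so on. -/
def System.largerSuccs (u : V) : Set V := {v | Relation.TransGen P.IsSucc u v}

/-- `P⁺(u)`. -/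
def System.largerPreds (u : V) : Set V := {v | Relation.TransGen P.IsPred u v}

/-- `S⁻(u)`: the nodes whose first larger predecessor is `u`. -/
def System.smallerSuccs (u : V) : Set V := {v | P.IsPred v u}

/-- `P⁻(u)`: the nodes whose first larger successor is `u`. -/
def System.smallerPreds (u : V) : Set V := {v | P.IsSucc v u}

/-- The graph `G^CONE`. -/
def System.coneGraph : Digraph V where
  Adj u v := v ∈ P.largerSuccs u ∪ P.largerPreds u ∪ P.smallerSuccs u ∪ P.smallerPreds u

end Cone

/-! ### Program states -/

/-- Intervals of hash values (open, closed or half-open). -/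
abbrev Interval := {J : Set ℝ // J.OrdConnected}

/-- The maximal interval around `x` that is contained in `S`. -/
def component (S : Set ℝ) (x : ℝ) : Interval :=
  ⟨S.ordConnectedComponent x, inferInstance⟩

/-- An entry of the data set `u.DS`: an interval, the reference to the node that is assumed to
supervise it, and the data stored for it. -/
@[ext]
structure Entry (V D : Type*) where
  interval : Interval
  ref : V
  data : Finset D

inductive Msg (V D : Type*) where
  | buildTriangle (x : V)
  | listUpdate (L : Finset V)
  | checkInterval (J : Interval) (x : V)
  | updateInterval (I : Set (Interval × V))
  | forwardData (d : D)
  | storeData (d : D) (J : Interval) (x : V)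

/-- The internal variables of a node `u`: the lists `u.S⁺`, `u.P⁺`, `u.S⁻`, `u.P⁻` and the data
set `u.DS`. -/
@[ext]
structure NodeState (V D : Type*) where
  Sp : Finset V
  Pp : Finset V
  Sm : Finset V
  Pm : Finset V
  DS : Finset (Entry V D)

/-- A program state: the node states, and for each pair `(v, u)` the queue of the messages in the
FIFO channel from `v` to `u`, the oldest one first. -/
structure State (V D : Type*) where
  node : V → NodeState V D
  chan : V → V → List (Msg V D)

/-- Messages to be sent, with their destinations, in the order in which they are sent. -/
abbrev Outbox (V D : Type*) := List (V × Msg V D)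

section Choose

variable {V : Type*}

/-- An element of `s` with the least value of `p`, if `s` is not empty. -/
def argmin (p : V → ℝ) (s : Finset V) : Option V :=
  if hs : s.Nonempty then some (Classical.choose (s.exists_min_image p hs)) else none

/-- An element of `s` with the greatest value of `p`, if `s` is not empty. -/
def argmax (p : V → ℝ) (s : Finset V) : Option V := argmin (fun v => -p v) s

end Choose

section Variables

variable {V D : Type*}

/-- The data that a node stores. -/
def NodeState.stored (n : NodeState V D) : Finset D := n.DS.biUnion Entry.data

/-- All nodes in the four lists. -/
def NodeState.nbrs (n : NodeState V D) : Finset V := n.Sp ∪ n.Pp ∪ n.Sm ∪ n.Pm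

variable (P : System V D)

/-- `u.succ⁺₁` -/
def System.succ (n : NodeState V D) : Option V := argmin P.h n.Sp

/-- `u.pred⁺₁` -/
def System.pred (n : NodeState V D) : Option V := argmax P.h n.Pp

/-- `u.S*` -/
def System.Sstar (n : NodeState V D) : Finset V := n.Sm ∪ (P.succ n).toFinset

/-- `u.P*` -/
def System.Pstar (n : NodeState V D) : Finset V := n.Pm ∪ (P.pred n).toFinset

/-- `u.S*[1]`, the closest right neighbor of `u`. -/
def System.right (n : NodeState V D) : Option V := argmin P.h (P.Sstar n)

/-- `u.P*[1]`, the closest left neighbor of `u`. -/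
def System.left (n : NodeState V D) : Option V := argmax P.h (P.Pstar n)

/-- The interval `u.I_u` that `u` supervises: from `h u` to its closest right neighbor.  It extends
to the end of `[0, 1)` if there is no right neighbor, and from the beginning of `[0, 1)` if there
is no left neighbor. -/
def System.supervised (u : V) (n : NodeState V D) : Set ℝ :=
  {x | x ∈ Set.Ico (0 : ℝ) 1 ∧ (P.left n ≠ none → P.h u ≤ x) ∧ ∀ r ∈ P.right n, x < P.h r}

/-- `I_u(x)`: the part of `u.I_u` for which, as far as `u` knows, `x` is responsible. -/
def System.responsiblePart (u : V) (n : NodeState V D) (x : V) : Set ℝ :=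
  {y | y ∈ P.supervised u n ∧ ∀ v ∈ insert u n.nbrs, P.C x y ≤ P.C v y}

/-- The node which is, as far as `u` knows, responsible for the hash value `y`. -/
def System.responsibleNode (u : V) (n : NodeState V D) (y : ℝ) : V :=
  Classical.choose ((insert u n.nbrs).exists_min_image (fun v => P.C v y)
    (Finset.insert_nonempty u n.nbrs))

/-- The nodes `v ∈ X` with larger capacity than `u` that lie on the right of `u` with respect to
the position `p`, such that each node of `X` between `u` and `v` has smaller capacity than `v`.
The position `p` is `h` for the right and `-h` for the left side. -/
def System.larger (p : V → ℝ) (u : V) (X : Finset V) : Finset V :=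
  X.filter fun v => p u < p v ∧ P.c u < P.c v ∧ ∀ w ∈ X, p u < p w → p w < p v → P.c w < P.c v

/-- The same with smaller capacity than `u`. -/
def System.smaller (p : V → ℝ) (u : V) (X : Finset V) : Finset V :=
  X.filter fun v => p u < p v ∧ P.c v < P.c u ∧ ∀ w ∈ X, p u < p w → p w < p v → P.c w < P.c v

/-- The mirrored position. -/
def System.h' (v : V) : ℝ := -P.h v

/-- The lists of `u` satisfy their definitions. -/
def System.ValidLists (u : V) (n : NodeState V D) : Prop :=
  n.Sp = P.larger P.h u n.nbrs ∧ n.Pp = P.larger P.h' u n.nbrs ∧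
  n.Sm = P.smaller P.h u n.nbrs ∧ n.Pm = P.smaller P.h' u n.nbrs

/-- The graph of the explicit edges, without those given by the references in the data sets. -/
def State.explicitGraph (s : State V D) : Digraph V where
  Adj u v := v ∈ (s.node u).nbrs

/-- The explicit graph is the CONE graph, and the lists of all nodes are valid. -/
def System.IsCone (s : State V D) : Prop :=
  (∀ u, P.ValidLists u (s.node u)) ∧ s.explicitGraph = P.coneGraph

/-- Data recorded for an interval, in a data set or in a store-data message, lies in it. -/
def System.ValidData (s : State V D) : Prop :=
  (∀ u, ∀ e ∈ (s.node u).DS, ∀ d ∈ e.data, P.g d ∈ e.interval.1) ∧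
  ∀ v u d J x, Msg.storeData d J x ∈ s.chan v u → P.g d ∈ J.1

/-- The data elements present in the system, stored at a node or contained in a message. -/
def State.present (s : State V D) : Set D :=
  {d | (∃ u, d ∈ (s.node u).stored) ∨
    ∃ v u, Msg.forwardData d ∈ s.chan v u ∨ ∃ J x, Msg.storeData d J x ∈ s.chan v u}

end Variables

/-! ### The protocol: maintenance of the topology -/

section Topology

variable {V D : Type*} (P : System V D)

/-- Delegate each `w ∈ W` to the node of `T` that is the closest one before `w`, by a
build-triangle message. -/
def delegate (p : V → ℝ) (T W : Finset V) : Outbox V D :=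
  W.toList.filterMap fun w =>
    (argmax p (T.filter fun v => p v < p w)).map fun v => (v, Msg.buildTriangle w)

/-- `BuildTriangle(x)` at `u`. -/
def System.buildTriangle (u x : V) (n : NodeState V D) : NodeState V D × Outbox V D :=
  if P.c u < P.c x ∧ P.h u < P.h x ∧ ∀ r ∈ P.succ n, P.h x < P.h r then
    ({ n with Sp := insert x n.Sp },
      ((P.succ n).map fun r => (x, Msg.buildTriangle r)).toList)
  else if P.c u < P.c x ∧ P.h x < P.h u ∧ ∀ l ∈ P.pred n, P.h l < P.h x then
    ({ n with Pp := insert x n.Pp },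
      ((P.pred n).map fun l => (x, Msg.buildTriangle l)).toList)
  else if P.h u < P.h x then
    let T := P.smaller P.h u (insert x (n.Sm ∪ n.Sp))
    ({ n with Sm := T }, delegate P.h (T ∪ (P.succ n).toFinset) (insert x n.Sm \ T))
  else if P.h x < P.h u then
    let T := P.smaller P.h' u (insert x (n.Pm ∪ n.Pp))
    ({ n with Pm := T }, delegate P.h' (T ∪ (P.pred n).toFinset) (insert x n.Pm \ T))
  else (n, [])

/-- `BuildTriangle` for several nodes, one after the other. -/
def System.buildTriangles (u : V) : List V → NodeState V D → NodeState V D × Outbox V D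
  | [], n => (n, [])
  | x :: xs, n =>
    let r := P.buildTriangle u x n
    let r' := System.buildTriangles u xs r.1
    (r'.1, r.2 ++ r'.2)

/-- The first half of `ListUpdate`, for the list `old` of larger nodes on one side and the
candidates `cand`: the new list and the messages sent. -/
def System.updateLarger (p : V → ℝ) (u : V) (old cand : Finset V) : Finset V × Outbox V D :=
  let T := P.larger p u (old ∪ cand)
  let Z := (old \ cand) ∪ ((old ∪ cand) \ T)
  if old ≠ T then
    (T, Z.toList.filterMap fun z => (argmin p T).map fun t => (t, Msg.buildTriangle z))
  else (old, [])

/-- The second half of `ListUpdate`, for the list `old` of smaller nodes on one side, the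
candidates `cand` and the (new) list `lg` of larger nodes on this side. -/
def System.updateSmaller (p : V → ℝ) (u : V) (old cand lg : Finset V) :
    Finset V × Outbox V D :=
  let T := P.smaller p u (old ∪ cand ∪ lg)
  (T, delegate p (T ∪ (argmin p lg).toFinset) ((old ∪ cand) \ T))

/-- `ListUpdate(L)` at `u`. -/
def System.listUpdate (u : V) (L : Finset V) (n : NodeState V D) :
    NodeState V D × Outbox V D :=
  let pp := P.updateLarger (D := D) P.h' u n.Pp
    (L.filter fun z => P.h z < P.h u ∧ P.c u < P.c z)
  let sp := P.updateLarger (D := D) P.h u n.Sp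
    (L.filter fun z => P.h u < P.h z ∧ P.c u < P.c z)
  let pm := P.updateSmaller (D := D) P.h' u n.Pm
    (L.filter fun z => P.h z < P.h u ∧ P.c z < P.c u) pp.1
  let sm := P.updateSmaller (D := D) P.h u n.Sm
    (L.filter fun z => P.h u < P.h z ∧ P.c z < P.c u) sp.1
  ({ n with Sp := sp.1, Pp := pp.1, Sm := sm.1, Pm := pm.1 }, pp.2 ++ sp.2 ++ pm.2 ++ sm.2)

/-- The consistency check: the lists are made to satisfy their definitions, and the nodes that no
longer occur in them are delegated. -/
def System.consistencyCheck (u : V) (n : NodeState V D) : NodeState V D × Outbox V D :=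
  let n' : NodeState V D :=
    { n with
      Sp := P.larger P.h u n.nbrs
      Pp := P.larger P.h' u n.nbrs
      Sm := P.smaller P.h u n.nbrs
      Pm := P.smaller P.h' u n.nbrs }
  let W := n.nbrs \ n'.nbrs
  (n', delegate P.h (P.Sstar n') (W.filter fun v => P.h u < P.h v) ++
    delegate P.h' (P.Pstar n') (W.filter fun v => P.h v < P.h u))

/-- Each `w ∈ W` and the node of `T` that is the closest one before `w` are introduced to each
other. -/
def introducePairs (p : V → ℝ) (T W : Finset V) : Outbox V D :=
  W.toList.flatMap fun w =>
    match argmax p (T.filter fun v => p v < p w) with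
    | some v => [(v, Msg.buildTriangle w), (w, Msg.buildTriangle v)]
    | none => []

/-- The periodic introductions `BuildTriangle()`. -/
def System.introduce (u : V) (n : NodeState V D) : Outbox V D :=
  introducePairs P.h (P.Sstar n) n.Sm ++ introducePairs P.h' (P.Pstar n) n.Pm ++
  (P.Sstar n ∪ P.Pstar n).toList.map (fun w => (w, Msg.buildTriangle u)) ++
  match P.pred n, P.succ n with
  | some l, some r => [(r, Msg.buildTriangle l), (l, Msg.buildTriangle r)]
  | _, _ => []

end Topology

/-! ### The protocol: data management -/

section Data

variable {V D : Type*} (P : System V D)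

/-- `CheckDataIntervals()` -/
def checkDataIntervals (u : V) (n : NodeState V D) : Outbox V D :=
  n.DS.toList.map fun e => (e.ref, Msg.checkInterval e.interval u)

/-- The set `IntervalSet` computed by `u` in `CheckInterval(J, x)`: the part of `J` on the left of
`u`, the part of `J` beyond the right neighbor of `u`, and the subintervals of `J` that `u`
supervises and for which `x` is not responsible, each with a reference. -/
def System.intervalSet (u : V) (n : NodeState V D) (J : Interval) (x : V) :
    Set (Interval × V) :=
  {q | (∃ l ∈ P.left n, (J.1 ∩ Set.Iio (P.h u)).Nonempty ∧
      q.1.1 = J.1 ∩ Set.Iio (P.h u) ∧ q.2 = l) ∨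
    (∃ r ∈ P.right n, (J.1 ∩ Set.Ici (P.h r)).Nonempty ∧
      q.1.1 = J.1 ∩ Set.Ici (P.h r) ∧ q.2 = r) ∨
    ∃ y ∈ (J.1 ∩ P.supervised u n) \ P.responsiblePart u n x,
      q.1 = component ((J.1 ∩ P.supervised u n) \ P.responsiblePart u n x) y ∧ q.2 = u}

/-- `CheckInterval(J, x)` at `u`. -/
def System.checkInterval (u : V) (J : Interval) (x : V) (n : NodeState V D) :
    NodeState V D × Outbox V D :=
  let r := if x ∉ n.Pp ∪ n.Sp ∪ n.Sm then P.buildTriangle u x n else (n, [])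
  (r.1, r.2 ++ [(x, Msg.updateInterval (P.intervalSet u r.1 J x))])

/-- What is left of an entry when the points of `U` are removed: the remaining subintervals that
contain data, with this data and the old reference. -/
def System.cut (U : Set ℝ) (e : Entry V D) : Finset (Entry V D) :=
  (e.data.filter fun d => P.g d ∉ U).image fun d =>
    { interval := component (e.interval.1 \ U) (P.g d)
      ref := e.ref
      data := e.data.filter fun d' => P.g d' ∈ (component (e.interval.1 \ U) (P.g d)).1 }

/-- `UpdateDS()`: intervals without data are deleted, and consecutive intervals with the same
reference are united. -/
def System.updateDS (E : Finset (Entry V D)) : Finset (Entry V D) :=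
  let E' := E.filter fun e => e.data.Nonempty
  E'.biUnion fun e => e.data.image fun d =>
    let K := component {y | ∃ e' ∈ E', e'.ref = e.ref ∧ y ∈ e'.interval.1} (P.g d)
    { interval := K
      ref := e.ref
      data := ((E'.filter fun e' => e'.ref = e.ref).biUnion Entry.data).filter
        fun d' => P.g d' ∈ K.1 }

/-- The reference of an interval of `I` that contains `y`, if there is one. -/
def refOf (I : Set (Interval × V)) (y : ℝ) : Option V :=
  if hy : ∃ q ∈ I, y ∈ q.1.1 then some (Classical.choose hy).2 else none

/-- `UpdateInterval(I)` at `u`: the intervals in `I` are removed from the data set and the data in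
them is forwarded to the corresponding references.  The references in `I` and those of the deleted
intervals are passed to `BuildTriangle`. -/
def System.updateInterval [Fintype V] (u : V) (I : Set (Interval × V)) (n : NodeState V D) :
    NodeState V D × Outbox V D :=
  let U : Set ℝ := {y | ∃ q ∈ I, y ∈ q.1.1}
  let E := P.updateDS (n.DS.biUnion (P.cut U))
  let fwd : Outbox V D := n.stored.toList.filterMap fun d =>
    (refOf I (P.g d)).map fun r => (r, Msg.forwardData d)
  let refs := Finset.univ.filter fun r =>
    (∃ q ∈ I, q.2 = r) ∨ ((∃ e ∈ n.DS, e.ref = r) ∧ ¬ ∃ e ∈ E, e.ref = r)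
  let b := P.buildTriangles u refs.toList { n with DS := E }
  (b.1, fwd ++ b.2)

/-- The next hop of greedy routing from `u` towards the hash value `y`: the neighbor closest to
`y` among those between `u` and `y`, or the left neighbor of `u` if `y` lies between the two. -/
def System.nextHop (u : V) (n : NodeState V D) (y : ℝ) : Option V :=
  if ∃ l ∈ P.left n, P.h l ≤ y ∧ y ≤ P.h u then P.left n
  else argmin (fun w => |y - P.h w|) ((P.Pstar n ∪ P.Sstar n).filter fun w =>
    (P.h u < P.h w ∧ P.h w < y) ∨ (P.h w < P.h u ∧ y < P.h w))

/-- `ForwardData(d)` at `u`.  (If the lists are valid there always is a next hop; otherwise `u`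
keeps a message that it cannot forward.) -/
def System.forwardData (u : V) (d : D) (n : NodeState V D) : NodeState V D × Outbox V D :=
  if P.g d ∉ P.supervised u n then
    (n, [((P.nextHop u n (P.g d)).getD u, Msg.forwardData d)])
  else
    let v := P.responsibleNode u n (P.g d)
    (n, [(v, Msg.storeData d (component (P.responsiblePart u n v) (P.g d)) u)])

/-- `StoreData(d, J, x)` at `u`. -/
def System.storeData (u : V) (d : D) (J : Interval) (x : V) (n : NodeState V D) :
    NodeState V D × Outbox V D :=
  if ∃ e ∈ n.DS, e.interval = J then
    P.buildTriangles u ((n.DS.filter fun e => e.interval = J).image Entry.ref).toList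
      { n with
        DS := n.DS.image fun e =>
          if e.interval = J then { e with ref := x, data := insert d e.data } else e }
  else
    ({ n with DS := insert { interval := J, ref := x, data := {d} } n.DS }, [])

end Data

/-! ### Computations -/

section Computation

variable {V D : Type*} [Fintype V] (P : System V D)

/-- The periodic action of `u`. -/
def System.timerAction (u : V) (n : NodeState V D) : NodeState V D × Outbox V D :=
  let r := P.consistencyCheck u n
  (r.1, r.2 ++
    r.1.Sm.toList.map (fun w => (w, Msg.listUpdate (insert u r.1.Pp))) ++
    r.1.Pm.toList.map (fun w => (w, Msg.listUpdate (insert u r.1.Sp))) ++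
    P.introduce u r.1 ++ checkDataIntervals u r.1)

/-- The action of `u` on the receipt of a message. -/
def System.receiveAction (u : V) (n : NodeState V D) : Msg V D → NodeState V D × Outbox V D
  | .buildTriangle x => P.buildTriangle u x n
  | .listUpdate L => P.listUpdate u L n
  | .checkInterval J x => P.checkInterval u J x n
  | .updateInterval I => P.updateInterval u I n
  | .forwardData d => P.forwardData u d n
  | .storeData d J x => P.storeData u d J x n

/-- Install the new node state of `u` and put the messages sent by `u` into the channels. -/
def State.commit (s : State V D) (u : V) (r : NodeState V D × Outbox V D) : State V D where
  node := Function.update s.node u r.1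
  chan v w :=
    if v = u then s.chan v w ++ (r.2.filter fun o => o.1 = w).map Prod.snd else s.chan v w

/-- `timer u`: the periodic action of `u` is executed.  `receive v u`: the node `u` receives and
processes the oldest message in the channel from `v`. -/
inductive Action (V : Type*) where
  | timer (u : V)
  | receive (v u : V)

inductive System.Step : State V D → Action V → State V D → Prop
  | timer (s : State V D) (u : V) :
      System.Step s (.timer u) (s.commit u (P.timerAction u (s.node u)))
  | receive (s : State V D) (v u : V) (m : Msg V D) (ms : List (Msg V D))
      (hm : s.chan v u = m :: ms) :
      System.Step s (.receive v u)
        (State.commit { s with chan := Function.update s.chan v (Function.update (s.chan v) u ms) }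
          u (P.receiveAction u (s.node u) m))

/-- A fair computation: in each step an action is executed, the timer of each node goes off again
and again, and each channel that holds a message is eventually served (so that each message is
eventually delivered). -/
structure System.Computation where
  state : ℕ → State V D
  action : ℕ → Action V
  step : ∀ i, P.Step (state i) (action i) (state (i + 1))
  timer_fair : ∀ u i, ∃ j, i ≤ j ∧ action j = .timer u
  delivery : ∀ v u i, (state i).chan v u ≠ [] → ∃ j, i ≤ j ∧ action j = .receive v u

end Computation

end

end ConeDHT

namespace ConeDHT

open Classical

noncomputable section

section Extrema

variable {V : Type*}

/-! The topology is a fixed point of the protocol. In each direction the lists of `u` consist of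
records: nodes whose capacity exceeds that of every node between them and `u`. A node that is not a
record is blocked by a record, so computing a list from any candidate set that contains the true
records returns the true records (`larger_eq`, `smaller_eq`). Equality with the CONE graph makes
each node know its true records (`IsCone.settled`), and from then on no action changes a list.

With these lists, local knowledge is exact. On the interval supervised by `u`, a node unknown to `u`
is never better than some neighbor of `u`, so the part that `u` assigns to `x` is the supervised
interval intersected with `R(x)` (`Settled.responsiblePart`). The answer to an interval check
therefore covers exactly the points of the interval that the checked node should not keep under this
reference (`exists_intervalSet_iff`). Greedy routing strictly decreases `hops`.

For the dynamics, fix a hash value `y` and follow the chain of causes between message types.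
Fairness flushes the channels, so a property of all messages sent from some time on becomes a
property of all messages in transit (`eventually_chan`). In turn, store-data messages for `y` become
correct; wrong references for `y` disappear for good (`eventually_not_refers`); answers to checks
stop covering `y` (`eventually_updateInterval`); forward-data messages are no longer created and the
old ones run out of hops; store-data messages die out. No action creates or loses data
(`present_succ`), so a present element ends up stored somewhere, and only at a node whose range
contains its hash value. Uniqueness of the responsible node and finiteness of the present data
finish the proof. -/

theorem argmin_mem {p : V → ℝ} {s : Finset V} {a : V} (h : argmin p s = some a) : a ∈ s := by
  unfold argmin at h
  split_ifs at h with hs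
  cases h
  exact (Classical.choose_spec (s.exists_min_image p hs)).1

theorem argmin_le {p : V → ℝ} {s : Finset V} {a b : V} (h : argmin p s = some a) (hb : b ∈ s) :
    p a ≤ p b := by
  unfold argmin at h
  split_ifs at h with hs
  cases h
  exact (Classical.choose_spec (s.exists_min_image p hs)).2 b hb

theorem exists_argmin {p : V → ℝ} {s : Finset V} (hs : s.Nonempty) : ∃ a, argmin p s = some a := by
  unfold argmin
  rw [dif_pos hs]
  exact ⟨_, rfl⟩

end Extrema

/-! ### Record lists and their stability, supervised intervals, greedy routing -/

section Lists

variable {V D : Type*} [Fintype V] (P : System V D)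

/-- The node of greatest capacity strictly between `u` and `v` is a record as seen from `u`. Keeping
the position `p` general serves both sides, with `p = h` and `p = h'`. -/
theorem System.exists_record_between {p : V → ℝ} {u v w : V} (huw : p u < p w) (hwv : p w < p v)
    (hc : P.c v < P.c w) :
    ∃ z, p u < p z ∧ p z < p v ∧ P.c v < P.c z ∧
      (z ∈ P.larger p u Finset.univ ∨ z ∈ P.smaller p u Finset.univ) := by
  obtain ⟨z, hz, hmax⟩ := (Finset.univ.filter fun z => p u < p z ∧ p z < p v).exists_max_image P.c
    ⟨w, by simp [huw, hwv]⟩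
  simp only [Finset.mem_filter, Finset.mem_univ, true_and] at hz hmax
  have hrec : ∀ x, p u < p x → p x < p z → P.c x < P.c z := fun x h1 h2 =>
    lt_of_le_of_ne (hmax x ⟨h1, h2.trans hz.2⟩) fun h => by
      rw [P.c_inj h] at h2; exact lt_irrefl _ h2
  refine ⟨z, hz.1, hz.2, hc.trans_le (hmax w ⟨huw, hwv⟩), ?_⟩
  have hne : P.c u ≠ P.c z := fun h => by
    have := hz.1; rw [P.c_inj h] at this; exact lt_irrefl _ this
  rcases lt_or_gt_of_ne hne with h | h
  · left; simp only [System.larger, Finset.mem_filter, Finset.mem_univ, true_and]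
    exact ⟨hz.1, h, fun x _ => hrec x⟩
  · right; simp only [System.smaller, Finset.mem_filter, Finset.mem_univ, true_and]
    exact ⟨hz.1, h, fun x _ => hrec x⟩

/-- A record that blocks a node larger than `u` is itself larger than `u`, so only the larger
records need to be among the candidates. -/
theorem System.larger_eq {p : V → ℝ} {u : V} {X : Finset V}
    (hX : P.larger p u Finset.univ ⊆ X) : P.larger p u X = P.larger p u Finset.univ := by
  ext v
  constructor
  · intro hv
    simp only [System.larger, Finset.mem_filter, Finset.mem_univ, true_and] at hv ⊢
    refine ⟨hv.2.1, hv.2.2.1, fun w _ h1 h2 => ?_⟩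
    by_contra hcon
    have hc : P.c v < P.c w := lt_of_le_of_ne (not_lt.1 hcon) fun h => by
      rw [P.c_inj h] at h2; exact lt_irrefl _ h2
    obtain ⟨z, z1, z2, z3, hz⟩ := P.exists_record_between h1 h2 hc
    have hzX : z ∈ X := by
      rcases hz with hz | hz
      · exact hX hz
      · simp only [System.smaller, Finset.mem_filter] at hz
        exact absurd (hz.2.2.1.trans (hv.2.2.1.trans z3)) (lt_irrefl _)
    exact lt_asymm z3 (hv.2.2.2 z hzX z1 z2)
  · intro hv
    have hvX := hX hv
    simp only [System.larger, Finset.mem_filter, Finset.mem_univ, true_and] at hv ⊢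
    exact ⟨hvX, hv.1, hv.2.1, fun w _ => hv.2.2 w trivial⟩

/-- Here the blocking record may be larger or smaller than `u`, so both kinds must be candidates.
This is why the protocol adds the larger list when it recomputes the smaller one. -/
theorem System.smaller_eq {p : V → ℝ} {u : V} {X : Finset V}
    (hX : P.larger p u Finset.univ ⊆ X) (hX' : P.smaller p u Finset.univ ⊆ X) :
    P.smaller p u X = P.smaller p u Finset.univ := by
  ext v
  constructor
  · intro hv
    simp only [System.smaller, Finset.mem_filter, Finset.mem_univ, true_and] at hv ⊢
    refine ⟨hv.2.1, hv.2.2.1, fun w _ h1 h2 => ?_⟩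
    by_contra hcon
    have hc : P.c v < P.c w := lt_of_le_of_ne (not_lt.1 hcon) fun h => by
      rw [P.c_inj h] at h2; exact lt_irrefl _ h2
    obtain ⟨z, z1, z2, z3, hz⟩ := P.exists_record_between h1 h2 hc
    exact lt_asymm z3 (hv.2.2.2 z (hz.elim (fun h => hX h) fun h => hX' h) z1 z2)
  · intro hv
    have hvX := hX' hv
    simp only [System.smaller, Finset.mem_filter, Finset.mem_univ, true_and] at hv ⊢
    exact ⟨hvX, hv.1, hv.2.1, fun w _ => hv.2.2 w trivial⟩

/-- The lists of `u` are those computed from the set of all nodes. -/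
structure System.Settled (u : V) (n : NodeState V D) : Prop where
  Sp : n.Sp = P.larger P.h u Finset.univ
  Pp : n.Pp = P.larger P.h' u Finset.univ
  Sm : n.Sm = P.smaller P.h u Finset.univ
  Pm : n.Pm = P.smaller P.h' u Finset.univ

/-- The first larger node `s` after `u` is either `v` or lies before it; in the latter case `v`
beats `s`, being a record, and is still a record as seen from `s`. Induction moves along `p`. -/
theorem System.transGen_of_mem_larger {p : V → ℝ} (hp : Function.Injective p) {r : V → V → Prop}
    (hr : ∀ u v, p u < p v → P.c u < P.c v →
      (∀ w, p u < p w → P.c u < P.c w → p v ≤ p w) → r u v) {u v : V}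
    (hv : v ∈ P.larger p u Finset.univ) : Relation.TransGen r u v := by
  have wf : WellFounded fun a b : V => p b < p a := by
    have : IsTrans V fun a b : V => p b < p a := ⟨fun a b c h1 h2 => h2.trans h1⟩
    have : Std.Irrefl fun a b : V => p b < p a := ⟨fun a => lt_irrefl _⟩
    exact Finite.wellFounded_of_trans_of_irrefl _
  induction u using wf.induction with
  | _ u ih =>
    simp only [System.larger, Finset.mem_filter, Finset.mem_univ, true_and] at hv
    obtain ⟨s, hs, hmin⟩ := (Finset.univ.filter fun z => p u < p z ∧ P.c u < P.c z).exists_min_image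
      p ⟨v, by simp [hv.1, hv.2.1]⟩
    simp only [Finset.mem_filter, Finset.mem_univ, true_and] at hs hmin
    have hus : r u s := hr u s hs.1 hs.2 fun w h1 h2 => hmin w ⟨h1, h2⟩
    rcases (hmin v ⟨hv.1, hv.2.1⟩).eq_or_lt with h | h
    · rw [← hp h]; exact .single hus
    · refine .head hus (ih s hs.1 ?_)
      simp only [System.larger, Finset.mem_filter, Finset.mem_univ, true_and]
      exact ⟨h, hv.2.2 s trivial hs.1 h, fun w _ h1 => hv.2.2 w trivial (hs.1.trans h1)⟩

omit [Fintype V] in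
theorem System.h'_injective : Function.Injective P.h' := fun _ _ h =>
  P.h_inj (neg_injective h)

/-- Only one inclusion has to be checked, namely that the CONE neighbors include all true records.
Validity relative to the stored neighbors then gives equality of the lists. -/
theorem System.IsCone.settled {s : State V D} (hs : P.IsCone s) (u : V) :
    P.Settled u (s.node u) := by
  obtain ⟨hvalid, hgraph⟩ := hs
  have hadj : ∀ v, v ∈ (s.node u).nbrs ↔
      v ∈ P.largerSuccs u ∪ P.largerPreds u ∪ P.smallerSuccs u ∪ P.smallerPreds u := fun v => by
    have := congrArg (fun G : Digraph V => G.Adj u v) hgraph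
    exact iff_of_eq this
  have h1 : P.larger P.h u Finset.univ ⊆ (s.node u).nbrs := fun v hv => (hadj v).2 <|
    Or.inl <| Or.inl <| Or.inl <| P.transGen_of_mem_larger P.h_inj (fun _ _ a b c => ⟨a, b, c⟩) hv
  have h2 : P.larger P.h' u Finset.univ ⊆ (s.node u).nbrs := fun v hv => (hadj v).2 <|
    Or.inl <| Or.inl <| Or.inr <| P.transGen_of_mem_larger P.h'_injective
      (fun _ _ a b c => ⟨neg_lt_neg_iff.1 a, b, fun w h3 h4 =>
        neg_le_neg_iff.1 (c w (neg_lt_neg h3) h4)⟩) hv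
  have h3 : P.smaller P.h u Finset.univ ⊆ (s.node u).nbrs := fun v hv => (hadj v).2 <| by
    simp only [System.smaller, Finset.mem_filter, Finset.mem_univ, true_and] at hv
    refine Or.inl <| Or.inr ⟨hv.1, hv.2.1, fun w h4 h5 => ?_⟩
    by_contra h6
    exact lt_asymm h5 (hv.2.2 w trivial (not_le.1 h6) h4)
  have h4 : P.smaller P.h' u Finset.univ ⊆ (s.node u).nbrs := fun v hv => (hadj v).2 <| by
    simp only [System.smaller, Finset.mem_filter, Finset.mem_univ, true_and] at hv
    refine Or.inr ⟨neg_lt_neg_iff.1 hv.1, hv.2.1, fun w h4 h5 => ?_⟩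
    by_contra h6
    exact lt_asymm h5 (hv.2.2 w trivial (neg_lt_neg (not_le.1 h6)) (neg_lt_neg h4))
  obtain ⟨v1, v2, v3, v4⟩ := hvalid u
  exact ⟨v1.trans (P.larger_eq h1), v2.trans (P.larger_eq h2), v3.trans (P.smaller_eq h1 h3),
    v4.trans (P.smaller_eq h2 h4)⟩

variable {P} {u : V} {n : NodeState V D}

theorem System.Settled.buildTriangle (hn : P.Settled u n) (x : V) :
    (P.buildTriangle u x n).1 = n := by
  obtain ⟨a1, a2, a3, a4⟩ := hn
  unfold System.buildTriangle
  split_ifs with h1 h2 h3 h4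
  · exfalso
    -- The branch condition is vacuous when there is no `P.succ n`, so nonemptiness is needed too.
    -- Either `x` is in the list or a record blocking `x` is, hence `x` is not closer than the first
    -- list element.
    have hne : n.Sp.Nonempty ∧ ∃ z ∈ n.Sp, P.h z ≤ P.h x := by
      suffices h : ∃ z ∈ n.Sp, P.h z ≤ P.h x from ⟨h.imp fun _ h => h.1, h⟩
      by_cases hx : x ∈ n.Sp
      · exact ⟨x, hx, le_rfl⟩
      · rw [a1] at hx ⊢
        simp only [System.larger, Finset.mem_filter, Finset.mem_univ, true_and, not_and,
          not_forall] at hx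
        obtain ⟨w, -, b1, b2, b3⟩ := hx h1.2.1 h1.1
        obtain ⟨z, c1, c2, c3, c4⟩ := P.exists_record_between b1 b2
          (lt_of_le_of_ne (not_lt.1 b3) fun h => by
            rw [P.c_inj h] at b2; exact lt_irrefl _ b2)
        rcases c4 with c4 | c4
        · exact ⟨z, c4, c2.le⟩
        · simp only [System.smaller, Finset.mem_filter] at c4
          exact absurd (c4.2.2.1.trans (h1.1.trans c3)) (lt_irrefl _)
    obtain ⟨a, ha⟩ := exists_argmin (p := P.h) hne.1
    obtain ⟨z, hz, hzx⟩ := hne.2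
    exact absurd ((h1.2.2 a ha).trans_le (argmin_le ha hz)) (not_lt.2 hzx)
  · exfalso
    have hne : n.Pp.Nonempty ∧ ∃ z ∈ n.Pp, P.h x ≤ P.h z := by
      suffices h : ∃ z ∈ n.Pp, P.h x ≤ P.h z from ⟨h.imp fun _ h => h.1, h⟩
      by_cases hx : x ∈ n.Pp
      · exact ⟨x, hx, le_rfl⟩
      · rw [a2] at hx ⊢
        simp only [System.larger, Finset.mem_filter, Finset.mem_univ, true_and, not_and,
          not_forall] at hx
        obtain ⟨w, -, b1, b2, b3⟩ := hx (neg_lt_neg h2.2.1) h2.1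
        obtain ⟨z, c1, c2, c3, c4⟩ := P.exists_record_between b1 b2
          (lt_of_le_of_ne (not_lt.1 b3) fun h => by
            rw [P.c_inj h] at b2; exact lt_irrefl _ b2)
        rcases c4 with c4 | c4
        · exact ⟨z, c4, neg_le_neg_iff.1 c2.le⟩
        · simp only [System.smaller, Finset.mem_filter] at c4
          exact absurd (c4.2.2.1.trans (h2.1.trans c3)) (lt_irrefl _)
    obtain ⟨a, ha⟩ := exists_argmin (p := fun v => - P.h v) hne.1
    obtain ⟨z, hz, hzx⟩ := hne.2
    exact absurd ((neg_le_neg_iff.1 (argmin_le (p := fun v => - P.h v) ha hz)).trans_lt (h2.2.2 a ha)) (not_lt.2 hzx)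
  · have : P.smaller P.h u (insert x (n.Sm ∪ n.Sp)) = n.Sm := by
      rw [a3, a1]
      exact P.smaller_eq (fun v hv => by simp [hv]) (fun v hv => by simp [hv])
    simp only [this]
  · have : P.smaller P.h' u (insert x (n.Pm ∪ n.Pp)) = n.Pm := by
      rw [a4, a2]
      exact P.smaller_eq (fun v hv => by simp [hv]) (fun v hv => by simp [hv])
    simp only [this]
  · rfl

theorem System.Settled.buildTriangles (hn : P.Settled u n) (xs : List V) :
    (P.buildTriangles u xs n).1 = n := by
  induction xs with
  | nil => rfl
  | cons x xs ih => simp only [System.buildTriangles, hn.buildTriangle x, ih]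

theorem System.updateLarger_fst {p : V → ℝ} (cand : Finset V) :
    (P.updateLarger (D := D) p u (P.larger p u Finset.univ) cand).1 =
      P.larger p u Finset.univ := by
  unfold System.updateLarger
  rw [P.larger_eq (by simp)]
  simp

theorem System.updateSmaller_fst {p : V → ℝ} (cand : Finset V) :
    (P.updateSmaller (D := D) p u (P.smaller p u Finset.univ) cand
      (P.larger p u Finset.univ)).1 = P.smaller p u Finset.univ := by
  unfold System.updateSmaller
  exact P.smaller_eq (fun v hv => by simp [hv]) (fun v hv => by simp [hv])

theorem System.Settled.listUpdate (hn : P.Settled u n) (L : Finset V) :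
    (P.listUpdate u L n).1 = n := by
  unfold System.listUpdate
  simp only [hn.Sp, hn.Pp, hn.Sm, hn.Pm, System.updateLarger_fst, System.updateSmaller_fst]
  simp only [← hn.Sp, ← hn.Pp, ← hn.Sm, ← hn.Pm]

theorem System.Settled.consistencyCheck (hn : P.Settled u n) :
    (P.consistencyCheck u n).1 = n := by
  have h1 : P.larger P.h u n.nbrs = n.Sp := by
    rw [hn.Sp]; exact P.larger_eq fun v hv => by simp [NodeState.nbrs, hn.Sp, hv]
  have h2 : P.larger P.h' u n.nbrs = n.Pp := by
    rw [hn.Pp]; exact P.larger_eq fun v hv => by simp [NodeState.nbrs, hn.Pp, hv]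
  have h3 : P.smaller P.h u n.nbrs = n.Sm := by
    rw [hn.Sm]
    exact P.smaller_eq (fun v hv => by simp [NodeState.nbrs, hn.Sp, hv])
      fun v hv => by simp [NodeState.nbrs, hn.Sm, hv]
  have h4 : P.smaller P.h' u n.nbrs = n.Pm := by
    rw [hn.Pm]
    exact P.smaller_eq (fun v hv => by simp [NodeState.nbrs, hn.Pp, hv])
      fun v hv => by simp [NodeState.nbrs, hn.Pm, hv]
  unfold System.consistencyCheck
  simp only [h1, h2, h3, h4]

theorem System.Settled.congr {n' : NodeState V D} (hn : P.Settled u n) (h1 : n'.Sp = n.Sp)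
    (h2 : n'.Pp = n.Pp) (h3 : n'.Sm = n.Sm) (h4 : n'.Pm = n.Pm) : P.Settled u n' :=
  ⟨h1.trans hn.Sp, h2.trans hn.Pp, h3.trans hn.Sm, h4.trans hn.Pm⟩

/-! ### Supervised intervals -/

/-- The closest neighbor of `u` in the direction of increasing `p`. -/
theorem System.exists_star_le {p : V → ℝ} {w : V} (hw : p u < p w) :
    ∃ v ∈ P.smaller p u Finset.univ ∪ (argmin p (P.larger p u Finset.univ)).toFinset,
      p v ≤ p w := by
  obtain ⟨v, hv, hmin⟩ := (Finset.univ.filter fun z => p u < p z).exists_min_image p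
    ⟨w, by simp [hw]⟩
  simp only [Finset.mem_filter, Finset.mem_univ, true_and] at hv hmin
  have hne : P.c u ≠ P.c v := fun h => by
    rw [P.c_inj h] at hv; exact lt_irrefl _ hv
  rcases lt_or_gt_of_ne hne with h | h
  -- No node lies between `u` and its closest node `v`, so `v` is vacuously a record.
  · have hvl : v ∈ P.larger p u Finset.univ := by
      simp only [System.larger, Finset.mem_filter, Finset.mem_univ, true_and]
      exact ⟨hv, h, fun x _ h1 h2 => absurd (hmin x h1) (not_le.2 h2)⟩
    obtain ⟨a, ha⟩ := exists_argmin (p := p) ⟨v, hvl⟩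
    exact ⟨a, by simp [ha], (argmin_le ha hvl).trans (hmin w hw)⟩
  · refine ⟨v, Finset.mem_union_left _ ?_, hmin w hw⟩
    simp only [System.smaller, Finset.mem_filter, Finset.mem_univ, true_and]
    exact ⟨hv, h, fun x _ h1 h2 => absurd (hmin x h1) (not_le.2 h2)⟩

theorem System.lt_of_mem_star {p : V → ℝ} {v : V}
    (hv : v ∈ P.smaller p u Finset.univ ∪ (argmin p (P.larger p u Finset.univ)).toFinset) :
    p u < p v := by
  rcases Finset.mem_union.1 hv with hv | hv
  · simp only [System.smaller, Finset.mem_filter] at hv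
    exact hv.2.1
  · have := argmin_mem (Option.mem_toFinset.1 hv)
    simp only [System.larger, Finset.mem_filter] at this
    exact this.2.1

theorem System.Settled.Sstar (hn : P.Settled u n) : P.Sstar n =
    P.smaller P.h u Finset.univ ∪ (argmin P.h (P.larger P.h u Finset.univ)).toFinset := by
  rw [System.Sstar, System.succ, hn.Sm, hn.Sp]

theorem System.Settled.Pstar (hn : P.Settled u n) : P.Pstar n =
    P.smaller P.h' u Finset.univ ∪ (argmin P.h' (P.larger P.h' u Finset.univ)).toFinset := by
  rw [System.Pstar, System.pred, hn.Pm, hn.Pp]; rfl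

theorem System.Settled.lt_of_right (hn : P.Settled u n) {r : V} (hr : r ∈ P.right n) :
    P.h u < P.h r := by
  have := argmin_mem hr
  rw [hn.Sstar] at this
  exact System.lt_of_mem_star this

theorem System.Settled.right_le (hn : P.Settled u n) {r w : V} (hr : r ∈ P.right n)
    (hw : P.h u < P.h w) : P.h r ≤ P.h w := by
  obtain ⟨v, hv, hvw⟩ := System.exists_star_le (P := P) hw
  rw [← hn.Sstar] at hv
  exact (argmin_le hr hv).trans hvw

theorem System.Settled.exists_right (hn : P.Settled u n) {w : V} (hw : P.h u < P.h w) :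
    ∃ r, r ∈ P.right n := by
  obtain ⟨v, hv, -⟩ := System.exists_star_le (P := P) hw
  rw [← hn.Sstar] at hv
  exact exists_argmin ⟨v, hv⟩

theorem System.Settled.left_lt (hn : P.Settled u n) {l : V} (hl : l ∈ P.left n) :
    P.h l < P.h u := by
  have := argmin_mem hl
  rw [hn.Pstar] at this
  exact neg_lt_neg_iff.1 (System.lt_of_mem_star (p := P.h') this)

theorem System.Settled.le_left (hn : P.Settled u n) {l w : V} (hl : l ∈ P.left n)
    (hw : P.h w < P.h u) : P.h w ≤ P.h l := by
  obtain ⟨v, hv, hvw⟩ := System.exists_star_le (P := P) (p := P.h') (neg_lt_neg hw)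
  rw [← hn.Pstar] at hv
  exact neg_le_neg_iff.1 ((argmin_le (p := P.h') hl hv).trans hvw)

theorem System.Settled.exists_left (hn : P.Settled u n) {w : V} (hw : P.h w < P.h u) :
    ∃ l, l ∈ P.left n := by
  obtain ⟨v, hv, -⟩ := System.exists_star_le (P := P) (p := P.h') (neg_lt_neg hw)
  rw [← hn.Pstar] at hv
  exact exists_argmin ⟨v, hv⟩

variable (P) in
/-- The interval supervised by `u` when its lists are settled. -/
def System.sector (u : V) : Set ℝ :=
  {x | x ∈ Set.Ico (0 : ℝ) 1 ∧ ((∃ w, P.h w < P.h u) → P.h u ≤ x) ∧ ∀ w, P.h u < P.h w → x < P.h w}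

theorem System.Settled.supervised (hn : P.Settled u n) : P.supervised u n = P.sector u := by
  ext x
  simp only [System.supervised, System.sector, Set.mem_ofPred_eq]
  refine and_congr_right fun _ => and_congr ⟨?_, ?_⟩ ⟨?_, ?_⟩
  · rintro h ⟨w, hw⟩
    obtain ⟨l, hl⟩ := hn.exists_left hw
    exact h (by rw [hl]; simp)
  · intro h hl
    obtain ⟨l, hl⟩ := Option.ne_none_iff_exists'.1 hl
    exact h ⟨l, hn.left_lt hl⟩
  · intro h w hw
    obtain ⟨r, hr⟩ := hn.exists_right hw
    exact (h r hr).trans_le (hn.right_le hr hw)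
  · exact fun h r hr => h r (hn.lt_of_right hr)

omit [Fintype V] in
-- Both factors of the capacity function shrink; multiplying the inequalities needs `f` to be
-- nonnegative, which is where `f 0 ≥ 0` enters.
theorem System.C_le_C {v w : V} {y : ℝ} (hy : y ∈ Set.Ico (0 : ℝ) 1) (hc : P.c v ≤ P.c w)
    (hd : |y - P.h w| ≤ |y - P.h v|) : P.C w y ≤ P.C v y := by
  have hmem : ∀ z, |y - P.h z| ∈ Set.Ico (0 : ℝ) 1 := fun z =>
    ⟨abs_nonneg _, abs_lt.2 ⟨by linarith [hy.1, (P.h_mem z).2], by linarith [hy.2, (P.h_mem z).1]⟩⟩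
  have hf : ∀ z, 0 ≤ P.f |y - P.h z| := fun z => P.f_zero_nonneg.trans <|
    P.f_strictMono.monotoneOn ⟨le_rfl, one_pos⟩ (hmem z) (abs_nonneg _)
  exact mul_le_mul (one_div_le_one_div_of_le (P.c_pos v) hc)
    (P.f_strictMono.monotoneOn (hmem w) (hmem v) hd) (hf w) (one_div_pos.2 (P.c_pos v)).le

/-- A non-neighbor `v` is blocked by a record `z` between `u` and `v` of larger capacity. Points of
the sector lie on the near side of `z`, so `z` is also closer to them than `v` is. -/
theorem System.Settled.exists_nbr_C_le (hn : P.Settled u n) {y : ℝ} (hy : y ∈ P.sector u)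
    (v : V) : ∃ w ∈ insert u n.nbrs, P.C w y ≤ P.C v y := by
  by_cases hv : v ∈ insert u n.nbrs
  · exact ⟨v, hv, le_rfl⟩
  simp only [NodeState.nbrs, Finset.mem_insert, Finset.mem_union, not_or, hn.Sp, hn.Pp, hn.Sm,
    hn.Pm] at hv
  obtain ⟨hvu, ⟨⟨h1, h2⟩, h3⟩, h4⟩ := hv
  have key : ∀ p : V → ℝ, p u < p v → v ∉ P.larger p u Finset.univ →
      v ∉ P.smaller p u Finset.univ → ∃ z, p u < p z ∧ p z < p v ∧ P.c v < P.c z ∧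
      (z ∈ P.larger p u Finset.univ ∨ z ∈ P.smaller p u Finset.univ) := by
    intro p hp hl hs
    have : ∃ w, p u < p w ∧ p w < p v ∧ P.c v < P.c w := by
      by_contra hcon
      push Not at hcon
      have hall : ∀ w, p u < p w → p w < p v → P.c w < P.c v := fun w a b =>
        lt_of_le_of_ne (hcon w a b) fun h => by rw [P.c_inj h] at b; exact lt_irrefl _ b
      rcases lt_or_gt_of_ne (P.c_inj.ne hvu) with h | h
      · exact hs (by simpa [System.smaller, hp, h] using hall)
      · exact hl (by simpa [System.larger, hp, h] using hall)
    obtain ⟨w, a, b, c⟩ := this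
    exact P.exists_record_between a b c
  rcases lt_or_gt_of_ne (P.h_inj.ne hvu) with h | h
  · obtain ⟨z, z1, z2, z3, hz⟩ := key P.h' (neg_lt_neg h) h2 h4
    refine ⟨z, ?_, System.C_le_C hy.1 z3.le ?_⟩
    · simp only [NodeState.nbrs, Finset.mem_insert, Finset.mem_union, hn.Pp, hn.Pm]; tauto
    · have hu := hy.2.1 ⟨v, h⟩
      have z1' : P.h z < P.h u := neg_lt_neg_iff.1 z1
      have z2' : P.h v < P.h z := neg_lt_neg_iff.1 z2
      rw [abs_of_nonneg (by linarith), abs_of_nonneg (by linarith)]; linarith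
  · obtain ⟨z, z1, z2, z3, hz⟩ := key P.h h h1 h3
    refine ⟨z, ?_, System.C_le_C hy.1 z3.le ?_⟩
    · simp only [NodeState.nbrs, Finset.mem_insert, Finset.mem_union, hn.Sp, hn.Sm]; tauto
    · have := hy.2.2 z z1
      rw [abs_of_nonpos (by linarith), abs_of_nonpos (by linarith)]; linarith

theorem System.Settled.responsiblePart (hn : P.Settled u n) (x : V) :
    P.responsiblePart u n x = P.sector u ∩ P.R x := by
  ext y
  simp only [System.responsiblePart, hn.supervised, Set.mem_inter_iff, Set.mem_ofPred_eq]
  refine and_congr_right fun hy => ⟨fun h => ⟨hy.1, fun v => ?_⟩, fun h v _ => h.2 v⟩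
  obtain ⟨w, hw, hwv⟩ := hn.exists_nbr_C_le hy v
  exact (h w hw).trans hwv

theorem component_subset (S : Set ℝ) (x : ℝ) : (component S x).1 ⊆ S :=
  Set.ordConnectedComponent_subset

theorem mem_component {S : Set ℝ} {x : ℝ} (hx : x ∈ S) : x ∈ (component S x).1 :=
  Set.self_mem_ordConnectedComponent.2 hx

theorem System.Settled.exists_intervalSet_iff (hn : P.Settled u n) {J : Interval} {x : V} {y : ℝ}
    (hy : y ∈ Set.Ico (0 : ℝ) 1) :
    (∃ q ∈ P.intervalSet u n J x, y ∈ q.1.1) ↔ y ∈ J.1 ∧ ¬ (y ∈ P.sector u ∧ y ∈ P.R x) := by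
  simp only [System.intervalSet, hn.responsiblePart, hn.supervised]
  constructor
  · rintro ⟨q, (⟨l, hl, -, hq, -⟩ | ⟨r, hr, -, hq, -⟩ | ⟨z, hz, hq, -⟩), hyq⟩
    · rw [hq] at hyq
      exact ⟨hyq.1, fun h => absurd (h.1.2.1 ⟨l, hn.left_lt hl⟩) (not_le.2 hyq.2)⟩
    · rw [hq] at hyq
      exact ⟨hyq.1, fun h => absurd (h.1.2.2 r (hn.lt_of_right hr)) (not_lt.2 hyq.2)⟩
    · rw [hq] at hyq
      have := component_subset _ _ hyq
      exact ⟨this.1.1, fun h => this.2 h⟩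
  · rintro ⟨hJ, hne⟩
    by_cases hs : y ∈ P.sector u
    · have hm : y ∈ (J.1 ∩ P.sector u) \ (P.sector u ∩ P.R x) := ⟨⟨hJ, hs⟩, hne⟩
      exact ⟨(component _ y, u), Or.inr (Or.inr ⟨y, hm, rfl, rfl⟩), mem_component hm⟩
    -- Outside the sector, `y` lies left of `u` while some node precedes `u`, or it lies at or
    -- beyond some node to the right. The two directional intervals catch these cases.
    · by_cases h1 : (∃ w, P.h w < P.h u) ∧ y < P.h u
      · obtain ⟨⟨w, hw⟩, h1⟩ := h1
        obtain ⟨l, hl⟩ := hn.exists_left hw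
        exact ⟨(⟨J.1 ∩ Set.Iio (P.h u), J.2.inter Set.ordConnected_Iio⟩, l),
          Or.inl ⟨l, hl, ⟨y, hJ, h1⟩, rfl, rfl⟩, hJ, h1⟩
      · have h2 : ∃ w, P.h u < P.h w ∧ P.h w ≤ y := by
          by_contra hcon
          push Not at hcon h1
          exact hs ⟨hy, h1, hcon⟩
        obtain ⟨w, hw, hwy⟩ := h2
        obtain ⟨r, hr⟩ := hn.exists_right hw
        have hry := (hn.right_le hr hw).trans hwy
        exact ⟨(⟨J.1 ∩ Set.Ici (P.h r), J.2.inter Set.ordConnected_Ici⟩, r),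
          Or.inr (Or.inl ⟨r, hr, ⟨y, hJ, hry⟩, rfl, rfl⟩), hJ, hry⟩

/-! ### Routing -/

variable (P) in
/-- An upper bound for the number of hops from `u` to the node that supervises `y`. -/
def System.hops (y : ℝ) (u : V) : ℕ :=
  if y ∈ P.sector u then 0
  else 1 + (Finset.univ.filter fun w => |y - P.h w| < |y - P.h u|).card

/-- The node `w` is counted for `u` but not for itself, so the set of strictly closer nodes shrinks
properly. -/
theorem System.hops_lt_of_closer {y : ℝ} {w : V} (hu : y ∉ P.sector u)
    (h : |y - P.h w| < |y - P.h u|) : P.hops y w < P.hops y u := by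
  unfold System.hops
  rw [if_neg hu]
  split_ifs with hw
  · omega
  · have : (Finset.univ.filter fun z => |y - P.h z| < |y - P.h w|).card <
        (Finset.univ.filter fun z => |y - P.h z| < |y - P.h u|).card := by
      refine Finset.card_lt_card ⟨fun z hz => ?_, fun hsub => ?_⟩
      · simp only [Finset.mem_filter, Finset.mem_univ, true_and] at hz ⊢
        exact hz.trans h
      · have := @hsub w (by simpa using h)
        simp at this
    omega

theorem System.Settled.hops_nextHop (hn : P.Settled u n) {d : D} (hu : P.g d ∉ P.sector u) :
    P.hops (P.g d) ((P.nextHop u n (P.g d)).getD u) < P.hops (P.g d) u := by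
  set y := P.g d with hy
  unfold System.nextHop
  split_ifs with h
  -- The hop to the left neighbor may increase the distance to `y`. But this neighbor supervises
  -- `y`, so its bound is 0, while that of `u` is at least 1.
  · obtain ⟨l, hl, h1, h2⟩ := h
    have hs : y ∈ P.sector l := ⟨P.g_mem d, fun _ => h1, fun w hw => by
      rcases lt_or_ge (P.h w) (P.h u) with h3 | h3
      · exact absurd (hn.le_left hl h3) (not_le.2 hw)
      · exact (lt_of_le_of_ne h2 (P.g_ne_h d u)).trans_le h3⟩
    have hl' : P.left n = some l := hl
    rw [hl', Option.getD_some, System.hops, if_pos hs, System.hops, if_neg hu]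
    omega
  -- A candidate exists on the side of `y`, since otherwise `y` would lie in the sector of `u` or
  -- the first branch would apply. The default value of `getD` is thus never used.
  · have hne : ((P.Pstar n ∪ P.Sstar n).filter fun w =>
        (P.h u < P.h w ∧ P.h w < y) ∨ (P.h w < P.h u ∧ y < P.h w)).Nonempty := by
      rcases lt_or_gt_of_ne (P.g_ne_h d u) with h1 | h1
      · have : ∃ w, P.h w < P.h u := by
          by_contra hcon
          exact hu ⟨P.g_mem d, fun h => absurd h hcon, fun w hw => h1.trans hw⟩
        obtain ⟨w, hw⟩ := this
        obtain ⟨l, hl⟩ := hn.exists_left hw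
        refine ⟨l, ?_⟩
        have h3 : y < P.h l := not_le.1 fun h3 => h ⟨l, hl, h3, h1.le⟩
        simp only [Finset.mem_filter, Finset.mem_union]
        exact ⟨Or.inl (argmin_mem hl), Or.inr ⟨hn.left_lt hl, h3⟩⟩
      · have : ∃ w, P.h u < P.h w ∧ P.h w ≤ y := by
          by_contra hcon
          push Not at hcon
          exact hu ⟨P.g_mem d, fun _ => h1.le, hcon⟩
        obtain ⟨w, hw, hwy⟩ := this
        obtain ⟨r, hr⟩ := hn.exists_right hw
        refine ⟨r, ?_⟩
        simp only [Finset.mem_filter, Finset.mem_union]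
        exact ⟨Or.inr (argmin_mem hr), Or.inl ⟨hn.lt_of_right hr,
          lt_of_le_of_ne ((hn.right_le hr hw).trans hwy) (P.g_ne_h d r).symm⟩⟩
    obtain ⟨a, ha⟩ := exists_argmin (p := fun w => |y - P.h w|) hne
    rw [ha, Option.getD_some]
    have := (Finset.mem_filter.1 (argmin_mem ha)).2
    refine System.hops_lt_of_closer hu ?_
    rcases this with ⟨h1, h2⟩ | ⟨h1, h2⟩
    · rw [abs_of_pos (by linarith), abs_of_pos (by linarith)]; linarith
    · rw [abs_of_neg (by linarith), abs_of_neg (by linarith)]; linarith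

end Lists

/-! ### Cutting and uniting the entries of a data set -/

section DataSets

variable {V D : Type*} {P : System V D}

theorem NodeState.mem_stored {n : NodeState V D} {d : D} :
    d ∈ n.stored ↔ ∃ e ∈ n.DS, d ∈ e.data := by
  simp [NodeState.stored]

theorem System.mem_cut {U : Set ℝ} {e e' : Entry V D} (h : e' ∈ P.cut U e) :
    e'.ref = e.ref ∧ e'.interval.1 ⊆ e.interval.1 \ U ∧
      ∀ d ∈ e'.data, d ∈ e.data ∧ P.g d ∈ e'.interval.1 := by
  simp only [System.cut, Finset.mem_image] at h
  obtain ⟨d, -, rfl⟩ := h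
  exact ⟨rfl, component_subset _ _, fun d' hd' => Finset.mem_filter.1 hd'⟩

/-- Data recorded outside its interval could get lost in a cut; the validity hypothesis on data
excludes this. -/
theorem System.exists_mem_cut {U : Set ℝ} {e : Entry V D} {d : D} (hd : d ∈ e.data)
    (he : P.g d ∈ e.interval.1) (hU : P.g d ∉ U) : ∃ e' ∈ P.cut U e, d ∈ e'.data := by
  refine ⟨_, Finset.mem_image_of_mem _ (Finset.mem_filter.2 ⟨hd, hU⟩), ?_⟩
  exact Finset.mem_filter.2 ⟨hd, mem_component ⟨he, hU⟩⟩

/-- Uniting entries adds no point to what a reference already covers, so removed points do not come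
back. -/
theorem System.mem_updateDS {E : Finset (Entry V D)} {e : Entry V D} (h : e ∈ P.updateDS E) :
    (∀ y ∈ e.interval.1, ∃ e' ∈ E, e'.ref = e.ref ∧ y ∈ e'.interval.1) ∧
      ∀ d ∈ e.data, P.g d ∈ e.interval.1 ∧ ∃ e' ∈ E, d ∈ e'.data := by
  simp only [System.updateDS, Finset.mem_biUnion, Finset.mem_image] at h
  obtain ⟨e₀, -, d, -, rfl⟩ := h
  constructor
  · intro y hy
    obtain ⟨e', he', hr, hy'⟩ := component_subset _ _ hy
    exact ⟨e', (Finset.mem_filter.1 he').1, hr, hy'⟩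
  · intro d' hd'
    obtain ⟨h1, h2⟩ := Finset.mem_filter.1 hd'
    obtain ⟨e', he', hd''⟩ := Finset.mem_biUnion.1 h1
    exact ⟨h2, e', (Finset.mem_filter.1 (Finset.mem_filter.1 he').1).1, hd''⟩

theorem System.exists_mem_updateDS {E : Finset (Entry V D)} {e : Entry V D} {d : D} (he : e ∈ E)
    (hd : d ∈ e.data) (hg : P.g d ∈ e.interval.1) : ∃ e' ∈ P.updateDS E, d ∈ e'.data := by
  have he' : e ∈ E.filter fun e => e.data.Nonempty := Finset.mem_filter.2 ⟨he, ⟨d, hd⟩⟩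
  refine ⟨_, Finset.mem_biUnion.2 ⟨e, he', Finset.mem_image_of_mem _ hd⟩, ?_⟩
  exact Finset.mem_filter.2 ⟨Finset.mem_biUnion.2 ⟨e, Finset.mem_filter.2 ⟨he', rfl⟩, hd⟩,
    mem_component ⟨e, he', rfl, hg⟩⟩

/-- The data recorded for an interval lies in it. -/
def System.ValidNode (P : System V D) (n : NodeState V D) : Prop :=
  ∀ e ∈ n.DS, ∀ d ∈ e.data, P.g d ∈ e.interval.1

theorem exists_refOf {I : Set (Interval × V)} {y : ℝ} :
    (∃ r, refOf I y = some r) ↔ ∃ q ∈ I, y ∈ q.1.1 := by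
  unfold refOf
  split_ifs with h <;> simp [h]

end DataSets

/-! ### Messages that do not concern data -/

section Maintenance

variable {V D : Type*}

/-- The messages that serve the maintenance of the topology only. -/
def Msg.Maintenance : Msg V D → Prop
  | .buildTriangle _ => True
  | .listUpdate _ => True
  | _ => False

theorem maintenance_delegate {p : V → ℝ} {T W : Finset V} {o : V × Msg V D}
    (ho : o ∈ delegate p T W) : o.2.Maintenance := by
  simp only [delegate, List.mem_filterMap, Option.map_eq_some_iff] at ho
  obtain ⟨w, -, v, -, rfl⟩ := ho
  trivial

variable {P : System V D} {u : V} {n : NodeState V D} {o : V × Msg V D}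

theorem System.maintenance_buildTriangle {x : V} (ho : o ∈ (P.buildTriangle u x n).2) :
    o.2.Maintenance := by
  unfold System.buildTriangle at ho
  split_ifs at ho
  · simp only [Option.mem_toList, Option.map_eq_some_iff] at ho
    obtain ⟨v, -, rfl⟩ := ho
    trivial
  · simp only [Option.mem_toList, Option.map_eq_some_iff] at ho
    obtain ⟨v, -, rfl⟩ := ho
    trivial
  · exact maintenance_delegate ho
  · exact maintenance_delegate ho
  · simp at ho

theorem System.maintenance_buildTriangles {xs : List V}
    (ho : o ∈ (P.buildTriangles u xs n).2) : o.2.Maintenance := by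
  induction xs generalizing n with
  | nil => simp [System.buildTriangles] at ho
  | cons x xs ih =>
    simp only [System.buildTriangles, List.mem_append] at ho
    exact ho.elim System.maintenance_buildTriangle ih

theorem System.maintenance_updateLarger {p : V → ℝ} {old cand : Finset V}
    (ho : o ∈ (P.updateLarger p u old cand).2) : o.2.Maintenance := by
  simp only [System.updateLarger] at ho
  split_ifs at ho
  · simp only [List.mem_filterMap, Option.map_eq_some_iff] at ho
    obtain ⟨w, -, v, -, rfl⟩ := ho
    trivial
  · simp at ho

theorem System.maintenance_listUpdate {L : Finset V} (ho : o ∈ (P.listUpdate u L n).2) :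
    o.2.Maintenance := by
  simp only [System.listUpdate, List.mem_append] at ho
  rcases ho with ((ho | ho) | ho) | ho
  · exact System.maintenance_updateLarger ho
  · exact System.maintenance_updateLarger ho
  · exact maintenance_delegate ho
  · exact maintenance_delegate ho

theorem System.maintenance_consistencyCheck (ho : o ∈ (P.consistencyCheck u n).2) :
    o.2.Maintenance := by
  simp only [System.consistencyCheck, List.mem_append] at ho
  exact ho.elim maintenance_delegate maintenance_delegate

theorem maintenance_introducePairs {p : V → ℝ} {T W : Finset V}
    (ho : o ∈ introducePairs (D := D) p T W) : o.2.Maintenance := by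
  simp only [introducePairs, List.mem_flatMap] at ho
  obtain ⟨w, -, ho⟩ := ho
  split at ho
  · simp only [List.mem_cons, List.not_mem_nil, or_false] at ho
    rcases ho with rfl | rfl <;> trivial
  · simp at ho

theorem System.maintenance_introduce (ho : o ∈ P.introduce u n) : o.2.Maintenance := by
  simp only [System.introduce, List.mem_append] at ho
  rcases ho with ((ho | ho) | ho) | ho
  · exact maintenance_introducePairs ho
  · exact maintenance_introducePairs ho
  · obtain ⟨w, -, rfl⟩ := List.mem_map.1 ho
    trivial
  · split at ho
    · simp only [List.mem_cons, List.not_mem_nil, or_false] at ho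
      rcases ho with rfl | rfl <;> trivial
    · simp at ho

end Maintenance

/-! ### Effect of a single action on a settled node -/

section Actions

variable {V D : Type*} [Fintype V] {P : System V D} {u : V} {n : NodeState V D}

theorem System.Settled.timerAction_fst (hn : P.Settled u n) : (P.timerAction u n).1 = n :=
  hn.consistencyCheck

theorem System.Settled.mem_timerAction (hn : P.Settled u n) {o : V × Msg V D}
    (ho : o ∈ (P.timerAction u n).2) : o.2.Maintenance ∨
      ∃ e ∈ n.DS, o = (e.ref, Msg.checkInterval e.interval u) := by
  simp only [System.timerAction, hn.consistencyCheck, List.mem_append] at ho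
  rcases ho with (((ho | ho) | ho) | ho) | ho
  · exact .inl (System.maintenance_consistencyCheck ho)
  · obtain ⟨w, -, rfl⟩ := List.mem_map.1 ho
    exact .inl trivial
  · obtain ⟨w, -, rfl⟩ := List.mem_map.1 ho
    exact .inl trivial
  · exact .inl (System.maintenance_introduce ho)
  · obtain ⟨e, he, rfl⟩ := List.mem_map.1 ho
    exact .inr ⟨e, Finset.mem_toList.1 he, rfl⟩

theorem System.Settled.checkInterval_mem_timerAction (hn : P.Settled u n) {e : Entry V D}
    (he : e ∈ n.DS) : (e.ref, Msg.checkInterval e.interval u) ∈ (P.timerAction u n).2 := by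
  simp only [System.timerAction, hn.consistencyCheck]
  exact List.mem_append_right _ (List.mem_map.2 ⟨e, Finset.mem_toList.2 he, rfl⟩)

theorem System.Settled.checkInterval (hn : P.Settled u n) (J : Interval) (x : V) :
    (P.checkInterval u J x n).1 = n ∧ ∀ o, o ∈ (P.checkInterval u J x n).2 →
      o.2.Maintenance ∨ o = (x, Msg.updateInterval (P.intervalSet u n J x)) := by
  unfold System.checkInterval
  split_ifs
  · simp
  · simp only [hn.buildTriangle, List.mem_append, List.mem_singleton, true_and]
    exact fun o ho => ho.imp_left System.maintenance_buildTriangle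

theorem System.Settled.updateInterval_mem_checkInterval (hn : P.Settled u n) (J : Interval)
    (x : V) : (x, Msg.updateInterval (P.intervalSet u n J x)) ∈ (P.checkInterval u J x n).2 := by
  unfold System.checkInterval
  split_ifs
  · simp
  · simp [hn.buildTriangle]

/-- The points covered by a set of intervals. -/
def cover (I : Set (Interval × V)) : Set ℝ := {y | ∃ q ∈ I, y ∈ q.1.1}

theorem System.Settled.buildTriangles_withDS (hn : P.Settled u n) (E : Finset (Entry V D))
    (xs : List V) : (P.buildTriangles u xs { n with DS := E }).1 = { n with DS := E } :=
  System.Settled.buildTriangles (n := { n with DS := E }) (hn.congr rfl rfl rfl rfl) xs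

theorem System.Settled.updateInterval_fst (hn : P.Settled u n) (I : Set (Interval × V)) :
    (P.updateInterval u I n).1 =
      { n with DS := P.updateDS (n.DS.biUnion (P.cut (cover I))) } := by
  unfold System.updateInterval
  exact hn.buildTriangles_withDS _ _

theorem System.mem_updateInterval {I : Set (Interval × V)} {o : V × Msg V D}
    (ho : o ∈ (P.updateInterval u I n).2) :
    o.2.Maintenance ∨ ∃ d ∈ n.stored, P.g d ∈ cover I ∧ o.2 = Msg.forwardData d := by
  simp only [System.updateInterval, List.mem_append, List.mem_filterMap,
    Option.map_eq_some_iff, Finset.mem_toList] at ho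
  rcases ho with ⟨d, hd, r, hr, rfl⟩ | ho
  · exact .inr ⟨d, hd, exists_refOf.1 ⟨r, hr⟩, rfl⟩
  · exact .inl (System.maintenance_buildTriangles ho)

theorem System.exists_forwardData_mem_updateInterval {I : Set (Interval × V)} {d : D}
    (hd : d ∈ n.stored) (hI : P.g d ∈ cover I) :
    ∃ w, (w, Msg.forwardData d) ∈ (P.updateInterval u I n).2 := by
  obtain ⟨r, hr⟩ := exists_refOf.2 hI
  refine ⟨r, ?_⟩
  simp only [System.updateInterval]
  refine List.mem_append_left _ (List.mem_filterMap.2 ⟨d, Finset.mem_toList.2 hd, ?_⟩)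
  rw [hr]; rfl

omit [Fintype V] in
theorem System.mem_DS_update {I : Set (Interval × V)} {e : Entry V D}
    (he : e ∈ P.updateDS (n.DS.biUnion (P.cut (cover I)))) :
    (∀ y ∈ e.interval.1, y ∉ cover I ∧ ∃ e' ∈ n.DS, e'.ref = e.ref ∧ y ∈ e'.interval.1) ∧
      ∀ d ∈ e.data, P.g d ∈ e.interval.1 ∧ d ∈ n.stored := by
  obtain ⟨h1, h2⟩ := System.mem_updateDS he
  constructor
  · intro y hy
    obtain ⟨e', he', hr, hy'⟩ := h1 y hy
    obtain ⟨e₀, he₀, he₀'⟩ := Finset.mem_biUnion.1 he'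
    obtain ⟨h3, h4, -⟩ := System.mem_cut he₀'
    exact ⟨(h4 hy').2, e₀, he₀, h3.symm.trans hr, (h4 hy').1⟩
  · intro d hd
    obtain ⟨h3, e', he', hd'⟩ := h2 d hd
    obtain ⟨e₀, he₀, he₀'⟩ := Finset.mem_biUnion.1 he'
    exact ⟨h3, NodeState.mem_stored.2 ⟨e₀, he₀, ((System.mem_cut he₀').2.2 d hd').1⟩⟩

omit [Fintype V] in
theorem System.ValidNode.exists_mem_DS_update (hv : P.ValidNode n) {I : Set (Interval × V)} {d : D}
    (hd : d ∈ n.stored) (hI : P.g d ∉ cover I) :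
    ∃ e ∈ P.updateDS (n.DS.biUnion (P.cut (cover I))), d ∈ e.data := by
  obtain ⟨e, he, hde⟩ := NodeState.mem_stored.1 hd
  obtain ⟨e', he', hde'⟩ := System.exists_mem_cut hde (hv e he d hde) hI
  exact System.exists_mem_updateDS (Finset.mem_biUnion.2 ⟨e, he, he'⟩) hde'
    ((System.mem_cut he').2.2 d hde').2

/-- The second clause controls which references and data can appear; the last two say that `d` gets
stored and nothing is dropped. -/
theorem System.Settled.storeData_fst (hn : P.Settled u n) (d : D) (J : Interval) (x : V) :
    (P.storeData u d J x n).1 = { n with DS := (P.storeData u d J x n).1.DS } ∧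
    (∀ e ∈ (P.storeData u d J x n).1.DS, e ∈ n.DS ∨
      (e.interval = J ∧ e.ref = x ∧ ∀ d' ∈ e.data, d' = d ∨ ∃ e' ∈ n.DS, e'.interval = J ∧
        d' ∈ e'.data)) ∧
    (∃ e ∈ (P.storeData u d J x n).1.DS, d ∈ e.data) ∧
    ∀ e ∈ n.DS, ∃ e' ∈ (P.storeData u d J x n).1.DS, e.data ⊆ e'.data := by
  unfold System.storeData
  split_ifs with h
  · rw [hn.buildTriangles_withDS]
    refine ⟨rfl, fun e he => ?_, ?_, fun e he => ?_⟩
    · obtain ⟨e', he', rfl⟩ := Finset.mem_image.1 he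
      split_ifs with hJ
      · refine .inr ⟨hJ, rfl, fun d' hd' => ?_⟩
        exact (Finset.mem_insert.1 hd').imp_right fun h => ⟨e', he', hJ, h⟩
      · exact .inl he'
    · obtain ⟨e, he, hJ⟩ := h
      exact ⟨_, Finset.mem_image_of_mem _ he, by rw [if_pos hJ]; exact Finset.mem_insert_self _ _⟩
    · refine ⟨_, Finset.mem_image_of_mem _ he, ?_⟩
      split_ifs
      · exact Finset.subset_insert _ _
      · exact Finset.Subset.refl _
  · refine ⟨rfl, fun e he => ?_, ⟨_, Finset.mem_insert_self _ _, Finset.mem_singleton_self _⟩,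
      fun e he => ⟨e, Finset.mem_insert_of_mem he, Finset.Subset.refl _⟩⟩
    rcases Finset.mem_insert.1 he with rfl | he
    · exact .inr ⟨rfl, rfl, fun d' hd' => .inl (Finset.mem_singleton.1 hd')⟩
    · exact .inl he

omit [Fintype V] in
theorem System.maintenance_storeData {d : D} {J : Interval} {x : V} {o : V × Msg V D}
    (ho : o ∈ (P.storeData u d J x n).2) : o.2.Maintenance := by
  unfold System.storeData at ho
  split_ifs at ho
  · exact System.maintenance_buildTriangles ho
  · simp at ho

omit [Fintype V] in
theorem System.forwardData_fst (d : D) : (P.forwardData u d n).1 = n := by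
  unfold System.forwardData
  split_ifs <;> rfl

theorem System.Settled.forwardData (hn : P.Settled u n) (d : D) :
    (P.g d ∉ P.sector u ∧ ∃ w, (P.forwardData u d n).2 = [(w, Msg.forwardData d)] ∧
      P.hops (P.g d) w < P.hops (P.g d) u) ∨
    (P.g d ∈ P.sector u ∧ ∃ w J, (P.forwardData u d n).2 = [(w, Msg.storeData d J u)] ∧
      P.g d ∈ J.1 ∧ J.1 ⊆ P.sector u ∩ P.R w) := by
  unfold System.forwardData
  rw [hn.supervised]
  split_ifs with h
  · refine .inr ⟨h, _, _, rfl, mem_component ?_, ?_⟩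
    · refine ⟨by rwa [hn.supervised], ?_⟩
      exact (Classical.choose_spec ((insert u n.nbrs).exists_min_image (fun v => P.C v (P.g d))
        (Finset.insert_nonempty u n.nbrs))).2
    · rw [← hn.responsiblePart]
      exact component_subset _ _
  · exact .inl ⟨h, _, rfl, hn.hops_nextHop h⟩

theorem System.Settled.receiveAction (hn : P.Settled u n) (m : Msg V D) :
    (P.receiveAction u n m).1 = { n with DS := (P.receiveAction u n m).1.DS } := by
  cases m with
  | buildTriangle x => simp only [System.receiveAction, hn.buildTriangle]
  | listUpdate L => simp only [System.receiveAction, hn.listUpdate]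
  | checkInterval J x => simp only [System.receiveAction, (hn.checkInterval J x).1]
  | updateInterval I => simp only [System.receiveAction, hn.updateInterval_fst]
  | forwardData d => simp only [System.receiveAction, System.forwardData_fst]
  | storeData d J x => exact (hn.storeData_fst d J x).1

end Actions

/-! ### Fair computations and FIFO channels -/

section Computations

variable {V D : Type*} [Fintype V] {P : System V D}

namespace System.Computation

variable (σ : P.Computation)

/-- In step `t`, the node `u` receives the message `m` from `v`. -/
def Received (t : ℕ) (v u : V) (m : Msg V D) : Prop :=
  σ.action t = .receive v u ∧ ((σ.state t).chan v u).head? = some m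

/-- In step `t`, the node `v` sends the message `m` to `w`. -/
def Sent (t : ℕ) (v w : V) (m : Msg V D) : Prop :=
  (σ.action t = .timer v ∧ (w, m) ∈ (P.timerAction v ((σ.state t).node v)).2) ∨
    ∃ x m', σ.Received t x v m' ∧ (w, m) ∈ (P.receiveAction v ((σ.state t).node v) m').2

/-- The message at the head of a channel is in it. -/
theorem Received.mem {σ : P.Computation} {t : ℕ} {v u : V} {m : Msg V D}
    (h : σ.Received t v u m) : m ∈ (σ.state t).chan v u :=
  List.mem_of_mem_head? h.2

theorem node_succ (t : ℕ) (v : V) :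
    (σ.state (t + 1)).node v = (σ.state t).node v ∨
    (σ.action t = .timer v ∧
      (σ.state (t + 1)).node v = (P.timerAction v ((σ.state t).node v)).1) ∨
    ∃ x m, σ.Received t x v m ∧
      (σ.state (t + 1)).node v = (P.receiveAction v ((σ.state t).node v) m).1 := by
  have hstep := σ.step t
  generalize hs : σ.state t = s at hstep
  generalize ha : σ.action t = a at hstep
  generalize hs' : σ.state (t + 1) = s' at hstep
  cases hstep with
  | timer u =>
    by_cases h : v = u
    · subst h; exact .inr (.inl ⟨rfl, by simp [State.commit]⟩)
    · exact .inl (by simp [State.commit, h])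
  | receive x u m ms hm =>
    by_cases h : v = u
    · subst h
      exact .inr (.inr ⟨x, m, ⟨ha, by rw [hs, hm]; rfl⟩, by simp [State.commit]⟩)
    · exact .inl (by simp [State.commit, h])

theorem node_of_received {t : ℕ} {x v : V} {m : Msg V D} (h : σ.Received t x v m) :
    (σ.state (t + 1)).node v = (P.receiveAction v ((σ.state t).node v) m).1 := by
  obtain ⟨h1, h2⟩ := h
  have hstep := σ.step t
  generalize σ.state t = s at hstep h2
  rw [h1] at hstep
  generalize σ.state (t + 1) = s' at hstep
  cases hstep with
  | receive x u m' ms hm =>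
    rw [hm] at h2
    cases h2
    simp [State.commit]

/-- The head is removed before the new messages are appended, so the formula also holds for a node
that sends to itself. -/
theorem chan_succ (t : ℕ) (v w : V) : ∃ new : List (Msg V D),
    (∀ m, m ∈ new ↔ σ.Sent t v w m) ∧
    (σ.state (t + 1)).chan v w = (if σ.action t = .receive v w then ((σ.state t).chan v w).tail
      else (σ.state t).chan v w) ++ new := by
  have hstep := σ.step t
  unfold Sent Received
  generalize σ.state t = s at hstep
  generalize σ.action t = a at hstep
  generalize σ.state (t + 1) = s' at hstep
  cases hstep with
  | timer u =>
    by_cases h : v = u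
    · subst h
      refine ⟨((P.timerAction v (s.node v)).2.filter fun o => o.1 = w).map Prod.snd, ?_, ?_⟩
      · intro m; simp
      · simp [State.commit]
    · exact ⟨[], by simp [Ne.symm h], by simp [State.commit, h]⟩
  | receive x u m ms hm =>
    have hchan : (if Action.receive x u = Action.receive v w then (s.chan v w).tail
        else s.chan v w) = Function.update s.chan x (Function.update (s.chan x) u ms) v w := by
      by_cases h : x = v
      · subst h
        by_cases h' : u = w
        · subst h'; simp [hm]
        · simp [h', Ne.symm h']
      · simp [h, Ne.symm h]
    rw [hchan]
    by_cases h : v = u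
    · subst h
      refine ⟨((P.receiveAction v (s.node v) m).2.filter fun o => o.1 = w).map Prod.snd, ?_, ?_⟩
      · intro m'
        simp [hm]
      · simp [State.commit]
    · exact ⟨[], by simp [Ne.symm h], by simp [State.commit, h]⟩

variable {σ}

theorem Sent.mem {t : ℕ} {v w : V} {m : Msg V D} (h : σ.Sent t v w m) :
    m ∈ (σ.state (t + 1)).chan v w := by
  obtain ⟨new, h1, h2⟩ := σ.chan_succ t v w
  rw [h2]
  exact List.mem_append_right _ ((h1 m).2 h)

theorem mem_chan_succ {t : ℕ} {v w : V} {m : Msg V D} (h : m ∈ (σ.state (t + 1)).chan v w) :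
    m ∈ (σ.state t).chan v w ∨ σ.Sent t v w m := by
  obtain ⟨new, h1, h2⟩ := σ.chan_succ t v w
  rw [h2, List.mem_append, h1] at h
  refine h.imp_left fun h => ?_
  split_ifs at h
  · exact List.mem_of_mem_tail h
  · exact h

theorem mem_chan_or_received {t : ℕ} {v w : V} {m : Msg V D} (h : m ∈ (σ.state t).chan v w) :
    m ∈ (σ.state (t + 1)).chan v w ∨ σ.Received t v w m := by
  obtain ⟨new, h1, h2⟩ := σ.chan_succ t v w
  rw [h2, List.mem_append]
  split_ifs with ha
  · cases hc : (σ.state t).chan v w with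
    | nil => rw [hc] at h; simp at h
    | cons a l =>
      rw [hc] at h
      rcases List.mem_cons.1 h with rfl | h
      · exact .inr ⟨ha, by rw [hc]; rfl⟩
      · exact .inl (.inl h)
  · exact .inl (.inl h)

theorem exists_received {t : ℕ} {v w : V} {m : Msg V D} (h : m ∈ (σ.state t).chan v w) :
    ∃ j, t ≤ j ∧ σ.Received j v w m := by
  by_contra hcon
  push Not at hcon
  -- Induction on the position in the queue: the message keeps its position until the channel is
  -- next served, then moves up by one, or is received if it is at the head.
  have key : ∀ k t' : ℕ, t ≤ t' → ((σ.state t').chan v w)[k]? = some m → False := by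
    intro k
    induction k with
    | zero =>
      intro t' ht' hk
      have hne : (σ.state t').chan v w ≠ [] := fun h => by simp [h] at hk
      obtain ⟨j, hj, hja⟩ := σ.delivery v w t' hne
      have hall : ∀ i, ((σ.state (t' + i)).chan v w)[0]? = some m := by
        intro i
        induction i with
        | zero => exact hk
        | succ i ih =>
          obtain ⟨new, -, h2⟩ := σ.chan_succ (t' + i) v w
          rw [← add_assoc, h2, if_neg fun ha => hcon (t' + i) (by omega) ⟨ha, by
            rw [← ih, List.head?_eq_getElem?]⟩]
          rw [List.getElem?_append_left (by
            obtain ⟨h, -⟩ := List.getElem?_eq_some_iff.1 ih; exact h), ih]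
      obtain ⟨i, rfl⟩ := Nat.exists_eq_add_of_le hj
      exact hcon _ (by omega) ⟨hja, by rw [← hall i, List.head?_eq_getElem?]⟩
    | succ k ihk =>
      intro t' ht' hk
      have hne : (σ.state t').chan v w ≠ [] := fun h => by simp [h] at hk
      obtain ⟨j, hj, hja⟩ := σ.delivery v w t' hne
      have hall : ∀ i, ((σ.state (t' + i)).chan v w)[k + 1]? = some m := by
        intro i
        induction i with
        | zero => exact hk
        | succ i ih =>
          obtain ⟨hlt, -⟩ := List.getElem?_eq_some_iff.1 ih
          obtain ⟨new, -, h2⟩ := σ.chan_succ (t' + i) v w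
          rw [← add_assoc, h2]
          split_ifs with ha
          · exfalso
            refine ihk (t' + i + 1) (by omega) ?_
            rw [h2, if_pos ha, List.getElem?_append_left (by rw [List.length_tail]; omega),
              List.getElem?_tail, ih]
          · rw [List.getElem?_append_left hlt, ih]
      obtain ⟨i, rfl⟩ := Nat.exists_eq_add_of_le hj
      obtain ⟨hlt, -⟩ := List.getElem?_eq_some_iff.1 (hall i)
      obtain ⟨new, -, h2⟩ := σ.chan_succ (t' + i) v w
      refine ihk (t' + i + 1) (by omega) ?_
      rw [h2, if_pos hja, List.getElem?_append_left (by rw [List.length_tail]; omega),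
        List.getElem?_tail, hall]
  obtain ⟨k, hk⟩ := List.mem_iff_getElem?.1 h
  exact key k t le_rfl hk

open Filter in
/-- If from some time on only messages with a certain property are sent, then eventually all
messages in the channels have this property. -/
theorem eventually_chan {Q : V → V → Msg V D → Prop}
    (hQ : ∀ᶠ t in atTop, ∀ v w m, σ.Sent t v w m → Q v w m) :
    ∀ᶠ t in atTop, ∀ v w, ∀ m ∈ (σ.state t).chan v w, Q v w m := by
  rw [eventually_all]; intro v
  rw [eventually_all]; intro w
  obtain ⟨T, hT⟩ := eventually_atTop.1 hQ
  -- The number `n` bounds the old messages at the front of the queue, about which nothing is known.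
  -- New messages are good and each service lowers `n` by one.
  have mono : ∀ n t, T ≤ t → (∀ m ∈ ((σ.state t).chan v w).drop n, Q v w m) →
      ∀ m ∈ ((σ.state (t + 1)).chan v w).drop
        (if σ.action t = .receive v w then n - 1 else n), Q v w m := by
    intro n t ht hn m hm
    obtain ⟨new, h1, h2⟩ := σ.chan_succ t v w
    rw [h2, List.drop_append, List.mem_append] at hm
    rcases hm with hm | hm
    · apply hn
      split_ifs at hm with ha
      · cases hc : (σ.state t).chan v w with
        | nil => simp [hc] at hm
        | cons a l =>
          rw [hc, List.tail_cons] at hm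
          cases n with
          | zero => exact List.mem_cons_of_mem _ hm
          | succ n => exact hm
      · exact hm
    · exact hT t ht v w m ((h1 m).1 (List.mem_of_mem_drop hm))
  have mono' : ∀ n t i, T ≤ t → (∀ m ∈ ((σ.state t).chan v w).drop n, Q v w m) →
      ∀ m ∈ ((σ.state (t + i)).chan v w).drop n, Q v w m := by
    intro n t i ht hn
    induction i with
    | zero => exact hn
    | succ i ih =>
      intro m hm
      refine mono n (t + i) (by omega) ih m ?_
      split_ifs
      · exact (List.drop_subset_drop_left _ (Nat.sub_le n 1)) hm
      · exact hm
  have key : ∀ n t, T ≤ t → (∀ m ∈ ((σ.state t).chan v w).drop n, Q v w m) →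
      ∃ t', T ≤ t' ∧ ∀ m ∈ ((σ.state t').chan v w).drop 0, Q v w m := by
    intro n
    induction n with
    | zero => exact fun t ht h => ⟨t, ht, h⟩
    | succ n ih =>
      intro t ht h
      by_cases he : (σ.state t).chan v w = []
      · exact ⟨t, ht, by simp [he]⟩
      · obtain ⟨j, hj, hja⟩ := σ.delivery v w t he
        obtain ⟨i, rfl⟩ := Nat.exists_eq_add_of_le hj
        have := mono (n + 1) (t + i) (by omega) (mono' _ t i ht h)
        rw [if_pos hja] at this
        exact ih (t + i + 1) (by omega) this
  obtain ⟨t', ht', h⟩ := key ((σ.state T).chan v w).length T le_rfl (by simp)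
  refine eventually_atTop.2 ⟨t', fun t ht m hm => ?_⟩
  obtain ⟨i, rfl⟩ := Nat.exists_eq_add_of_le ht
  exact mono' 0 t' i ht' h m hm

end System.Computation

end Computations

/-! ### Conservation of data and convergence -/

section Convergence

variable {V D : Type*} [Fintype V] {P : System V D}

namespace System.Computation

variable {σ : P.Computation} {t t₀ : ℕ}

theorem settled_succ (hn : ∀ u, P.Settled u ((σ.state t).node u)) (u : V) :
    P.Settled u ((σ.state (t + 1)).node u) := by
  rcases σ.node_succ t u with h | ⟨-, h⟩ | ⟨x, m, -, h⟩
  · rw [h]; exact hn u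
  · rw [h, (hn u).timerAction_fst]; exact hn u
  · rw [h, (hn u).receiveAction]; exact (hn u).congr rfl rfl rfl rfl

theorem settled_of_le (hn : ∀ u, P.Settled u ((σ.state t₀).node u)) (ht : t₀ ≤ t) (u : V) :
    P.Settled u ((σ.state t).node u) := by
  induction t, ht using Nat.le_induction generalizing u with
  | base => exact hn u
  | succ t _ ih => exact settled_succ ih u

/-- Apart from maintenance, each message has a traceable cause: a check comes from an entry, an
update from a check, a forwarding from an update or another forwarding, a storing from a forwarding.
The convergence argument follows these causes. -/
theorem Sent.cases {v w : V} {m : Msg V D} (h : σ.Sent t v w m)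
    (hn : P.Settled v ((σ.state t).node v)) :
    m.Maintenance ∨
    (∃ e ∈ ((σ.state t).node v).DS, w = e.ref ∧ m = .checkInterval e.interval v) ∨
    (∃ x J, σ.Received t x v (.checkInterval J w) ∧
      m = .updateInterval (P.intervalSet v ((σ.state t).node v) J w)) ∨
    (∃ x I, ∃ d ∈ ((σ.state t).node v).stored, σ.Received t x v (.updateInterval I) ∧
      P.g d ∈ cover I ∧ m = .forwardData d) ∨
    (∃ x d, σ.Received t x v (.forwardData d) ∧
      ((m = .forwardData d ∧ P.hops (P.g d) w < P.hops (P.g d) v) ∨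
      ∃ J, m = .storeData d J v ∧ P.g d ∈ J.1 ∧ J.1 ⊆ P.sector v ∩ P.R w)) := by
  rcases h with ⟨-, h⟩ | ⟨x, m', hr, h⟩
  · rcases hn.mem_timerAction h with h | ⟨e, he, h⟩
    · exact .inl h
    · cases h
      exact .inr (.inl ⟨e, he, rfl, rfl⟩)
  · cases m' with
    | buildTriangle x => exact .inl (System.maintenance_buildTriangle h)
    | listUpdate L => exact .inl (System.maintenance_listUpdate h)
    | checkInterval J y =>
      rcases (hn.checkInterval J y).2 _ h with h | h
      · exact .inl h
      · cases h
        exact .inr (.inr (.inl ⟨x, J, hr, rfl⟩))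
    | updateInterval I =>
      rcases System.mem_updateInterval h with h | ⟨d, hd, hI, h⟩
      · exact .inl h
      · exact .inr (.inr (.inr (.inl ⟨x, I, d, hd, hr, hI, h⟩)))
    | forwardData d =>
      refine .inr (.inr (.inr (.inr ⟨x, d, hr, ?_⟩)))
      rcases hn.forwardData d with ⟨-, w', h', hw⟩ | ⟨-, w', J, h', hJ⟩
      · rw [System.receiveAction, h', List.mem_singleton] at h
        cases h
        exact .inl ⟨rfl, hw⟩
      · rw [System.receiveAction, h', List.mem_singleton] at h
        cases h
        exact .inr ⟨J, rfl, hJ⟩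
    | storeData d J y => exact .inl (System.maintenance_storeData h)

theorem DS_succ {v : V} (hn : P.Settled v ((σ.state t).node v)) :
    ((σ.state (t + 1)).node v).DS = ((σ.state t).node v).DS ∨
    (∃ x I, σ.Received t x v (.updateInterval I) ∧ ((σ.state (t + 1)).node v).DS =
      P.updateDS (((σ.state t).node v).DS.biUnion (P.cut (cover I)))) ∨
    ∃ x d J r, σ.Received t x v (.storeData d J r) ∧ ((σ.state (t + 1)).node v).DS =
      (P.storeData v d J r ((σ.state t).node v)).1.DS := by
  rcases σ.node_succ t v with h | ⟨-, h⟩ | ⟨x, m, hr, h⟩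
  · exact .inl (by rw [h])
  · exact .inl (by rw [h, hn.timerAction_fst])
  · cases m with
    | buildTriangle y => exact .inl (by rw [h, System.receiveAction, hn.buildTriangle])
    | listUpdate L => exact .inl (by rw [h, System.receiveAction, hn.listUpdate])
    | checkInterval J y => exact .inl (by rw [h, System.receiveAction, (hn.checkInterval J y).1])
    | updateInterval I =>
      exact .inr (.inl ⟨x, I, hr, by rw [h, System.receiveAction, hn.updateInterval_fst]⟩)
    | forwardData d => exact .inl (by rw [h, System.receiveAction, System.forwardData_fst])
    | storeData d J r => exact .inr (.inr ⟨x, d, J, r, hr, by rw [h, System.receiveAction]⟩)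

theorem validData_succ (hn : ∀ u, P.Settled u ((σ.state t).node u))
    (hv : P.ValidData (σ.state t)) : P.ValidData (σ.state (t + 1)) := by
  constructor
  · intro u e he d hd
    rcases DS_succ (hn u) with h | ⟨x, I, -, h⟩ | ⟨x, d', J, r, hr, h⟩
    · rw [h] at he; exact hv.1 u e he d hd
    · rw [h] at he; exact ((System.mem_DS_update he).2 d hd).1
    · rw [h] at he
      rcases ((hn u).storeData_fst d' J r).2.1 e he with he | ⟨hJ, -, hdata⟩
      · exact hv.1 u e he d hd
      · rw [hJ]
        rcases hdata d hd with rfl | ⟨e', he', hJ', hd'⟩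
        · exact hv.2 _ _ _ _ _ hr.mem
        · rw [← hJ']; exact hv.1 u e' he' d hd'
  · intro v u d J x hm
    rcases mem_chan_succ hm with h | h
    · exact hv.2 v u d J x h
    · rcases h.cases (hn v) with h | ⟨e, -, -, h⟩ | ⟨_, _, -, h⟩ | ⟨_, _, _, -, -, -, h⟩ |
        ⟨_, _, -, ⟨h, -⟩ | ⟨J', h, hJ, -⟩⟩
      · exact h.elim
      · cases h
      · cases h
      · cases h
      · cases h
      · cases h; exact hJ

theorem validData_of_le (hn : ∀ u, P.Settled u ((σ.state t₀).node u))
    (hv : P.ValidData (σ.state t₀)) (ht : t₀ ≤ t) : P.ValidData (σ.state t) := by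
  induction t, ht using Nat.le_induction with
  | base => exact hv
  | succ t ht ih => exact validData_succ (settled_of_le hn ht) ih

/-- An element cut from a data set is forwarded in the same atomic action, and a received
forward-data or store-data message is passed on or stored at once. -/
theorem present_succ (hn : ∀ u, P.Settled u ((σ.state t).node u))
    (hv : P.ValidData (σ.state t)) : (σ.state (t + 1)).present = (σ.state t).present := by
  ext d
  constructor
  · rintro (⟨u, hd⟩ | ⟨v, u, hd | ⟨J, x, hd⟩⟩)
    · obtain ⟨e, he, hde⟩ := NodeState.mem_stored.1 hd
      rcases DS_succ (hn u) with h | ⟨x, I, -, h⟩ | ⟨x, d', J, r, hr, h⟩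
      · rw [h] at he; exact .inl ⟨u, NodeState.mem_stored.2 ⟨e, he, hde⟩⟩
      · rw [h] at he; exact .inl ⟨u, ((System.mem_DS_update he).2 d hde).2⟩
      · rw [h] at he
        rcases ((hn u).storeData_fst d' J r).2.1 e he with he | ⟨-, -, hdata⟩
        · exact .inl ⟨u, NodeState.mem_stored.2 ⟨e, he, hde⟩⟩
        · rcases hdata d hde with rfl | ⟨e', he', -, hd'⟩
          · exact .inr ⟨x, u, .inr ⟨J, r, hr.mem⟩⟩
          · exact .inl ⟨u, NodeState.mem_stored.2 ⟨e', he', hd'⟩⟩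
    · rcases mem_chan_succ hd with h | h
      · exact .inr ⟨v, u, .inl h⟩
      · rcases h.cases (hn v) with h | ⟨e, -, -, h⟩ | ⟨_, _, -, h⟩ | ⟨_, _, d', hd', -, -, h⟩ |
          ⟨x, d', hr, ⟨h, -⟩ | ⟨J', h, -⟩⟩
        · exact h.elim
        · cases h
        · cases h
        · cases h; exact .inl ⟨v, hd'⟩
        · cases h; exact .inr ⟨x, v, .inl hr.mem⟩
        · cases h
    · rcases mem_chan_succ hd with h | h
      · exact .inr ⟨v, u, .inr ⟨J, x, h⟩⟩
      · rcases h.cases (hn v) with h | ⟨e, -, -, h⟩ | ⟨_, _, -, h⟩ | ⟨_, _, d', hd', -, -, h⟩ |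
          ⟨x, d', hr, ⟨h, -⟩ | ⟨J', h, -⟩⟩
        · exact h.elim
        · cases h
        · cases h
        · cases h
        · cases h
        · cases h; exact .inr ⟨x, v, .inl hr.mem⟩
  · rintro (⟨u, hd⟩ | ⟨v, u, hd | ⟨J, x, hd⟩⟩)
    · rcases DS_succ (hn u) with h | ⟨x, I, hr, h⟩ | ⟨x, d', J, r, hr, h⟩
      · exact .inl ⟨u, by rw [NodeState.stored, h]; exact hd⟩
      · by_cases hI : P.g d ∈ cover I
        · obtain ⟨w, hw⟩ := System.exists_forwardData_mem_updateInterval (P := P) (u := u) hd hI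
          have hs : σ.Sent t u w (.forwardData d) := .inr ⟨x, _, hr, hw⟩
          exact .inr ⟨u, w, .inl hs.mem⟩
        · obtain ⟨e, he, hde⟩ := System.ValidNode.exists_mem_DS_update (hv.1 u) hd hI
          exact .inl ⟨u, NodeState.mem_stored.2 ⟨e, by rw [h]; exact he, hde⟩⟩
      · obtain ⟨e, he, hde⟩ := NodeState.mem_stored.1 hd
        obtain ⟨e', he', hsub⟩ := ((hn u).storeData_fst d' J r).2.2.2 e he
        exact .inl ⟨u, NodeState.mem_stored.2 ⟨e', by rw [h]; exact he', hsub hde⟩⟩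
    · rcases mem_chan_or_received hd with h | hr
      · exact .inr ⟨v, u, .inl h⟩
      · rcases (hn u).forwardData d with ⟨-, w, h, -⟩ | ⟨-, w, J, h, -⟩
        · have hs : σ.Sent t u w (.forwardData d) :=
            .inr ⟨v, _, hr, by rw [System.receiveAction, h]; exact List.mem_singleton_self _⟩
          exact .inr ⟨u, w, .inl hs.mem⟩
        · have hs : σ.Sent t u w (.storeData d J u) :=
            .inr ⟨v, _, hr, by rw [System.receiveAction, h]; exact List.mem_singleton_self _⟩
          exact .inr ⟨u, w, .inr ⟨J, u, hs.mem⟩⟩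
    · rcases mem_chan_or_received hd with h | hr
      · exact .inr ⟨v, u, .inr ⟨J, x, h⟩⟩
      · refine .inl ⟨u, ?_⟩
        rw [σ.node_of_received hr, NodeState.mem_stored]
        exact ((hn u).storeData_fst d J x).2.2.1

theorem present_of_le (hn : ∀ u, P.Settled u ((σ.state t₀).node u))
    (hv : P.ValidData (σ.state t₀)) (ht : t₀ ≤ t) :
    (σ.state t).present = (σ.state t₀).present := by
  induction t, ht using Nat.le_induction with
  | base => rfl
  | succ t ht ih => exact (present_succ (settled_of_le hn ht) (validData_of_le hn hv ht)).trans ih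

/-! ### Convergence for a single data element -/

open Filter

/-- Some entry of `x` with the reference `r` contains `y`. -/
def Refers (σ : P.Computation) (y : ℝ) (x r : V) (t : ℕ) : Prop :=
  ∃ e ∈ ((σ.state t).node x).DS, y ∈ e.interval.1 ∧ e.ref = r

theorem eventually_storeData (hn : ∀ᶠ t in atTop, ∀ u, P.Settled u ((σ.state t).node u)) (y : ℝ) :
    ∀ᶠ t in atTop, ∀ v w, ∀ m ∈ (σ.state t).chan v w, ∀ d J r, m = .storeData d J r → y ∈ J.1 →
      y ∈ P.sector r ∧ y ∈ P.R w := by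
  refine eventually_chan (Q := fun _ w m => ∀ d J r, m = .storeData d J r → y ∈ J.1 →
    y ∈ P.sector r ∧ y ∈ P.R w) ?_
  filter_upwards [hn] with t hn
  rintro v w m h d J r rfl hy
  rcases h.cases (hn v) with h | ⟨e, -, -, h⟩ | ⟨_, _, -, h⟩ | ⟨_, _, _, -, -, -, h⟩ |
    ⟨_, _, -, ⟨h, -⟩ | ⟨J', h, -, hJ⟩⟩
  · exact h.elim
  · cases h
  · cases h
  · cases h
  · cases h
  · cases h; exact hJ hy

/-- Once absent, a wrong reference stays absent: updates add no points, and late store-data messages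
only bring correct references. It cannot persist forever, because a check would be answered by an
update that removes `y`. -/
theorem eventually_not_refers (hn : ∀ᶠ t in atTop, ∀ u, P.Settled u ((σ.state t).node u)) {y : ℝ}
    (hy : y ∈ Set.Ico (0 : ℝ) 1) {x r : V} (hxr : ¬ (y ∈ P.sector r ∧ y ∈ P.R x)) :
    ∀ᶠ t in atTop, ¬ Refers σ y x r t := by
  obtain ⟨T, hT⟩ := eventually_atTop.1 (hn.and (eventually_storeData hn y))
  by_cases hex : ∃ t, T ≤ t ∧ ¬ Refers σ y x r t
  · obtain ⟨t₁, ht₁, h₁⟩ := hex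
    refine eventually_atTop.2 ⟨t₁, fun t ht => ?_⟩
    induction t, ht using Nat.le_induction with
    | base => exact h₁
    | succ t ht ih =>
      rintro ⟨e, he, hye, her⟩
      obtain ⟨hn, hs⟩ := hT t (ht₁.trans ht)
      rcases DS_succ (hn x) with h | ⟨_, I, -, h⟩ | ⟨v, d, J, r', hr, h⟩
      · rw [h] at he; exact ih ⟨e, he, hye, her⟩
      · rw [h] at he
        obtain ⟨-, e', he', h1, h2⟩ := (System.mem_DS_update he).1 y hye
        exact ih ⟨e', he', h2, h1.trans her⟩
      · rw [h] at he
        rcases ((hn x).storeData_fst d J r').2.1 e he with he | ⟨hJ, hr', -⟩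
        · exact ih ⟨e, he, hye, her⟩
        · have := hs v x _ hr.mem d J r' rfl (hJ ▸ hye)
          rw [← hr', her] at this
          exact hxr this
  · push Not at hex
    exfalso
    obtain ⟨j₁, hj₁, ha⟩ := σ.timer_fair x T
    obtain ⟨e, he, hye, rfl⟩ := hex j₁ hj₁
    have hs₁ : σ.Sent j₁ x e.ref (.checkInterval e.interval x) :=
      .inl ⟨ha, ((hT j₁ hj₁).1 x).checkInterval_mem_timerAction he⟩
    obtain ⟨j₂, hj₂, hr₂⟩ := exists_received hs₁.mem
    have hn₂ := (hT j₂ (by omega)).1 e.ref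
    have hs₂ : σ.Sent j₂ e.ref x (.updateInterval _) :=
      .inr ⟨x, _, hr₂, hn₂.updateInterval_mem_checkInterval e.interval x⟩
    obtain ⟨j₃, hj₃, hr₃⟩ := exists_received hs₂.mem
    -- This entry need not stem from `e`: the update removes `y` from all entries of `x`, so none
    -- can contain it right afterwards.
    obtain ⟨e', he', hye', -⟩ := hex (j₃ + 1) (by omega)
    rw [σ.node_of_received hr₃, System.receiveAction,
      ((hT j₃ (by omega)).1 x).updateInterval_fst] at he'
    exact ((System.mem_DS_update he').1 y hye').1 ((hn₂.exists_intervalSet_iff hy).2 ⟨hye, hxr⟩)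

/-- Correct references lead to correct checks, whose answers leave `y` alone. The channels are
flushed once for the checks and once for the answers. -/
theorem eventually_updateInterval (hn : ∀ᶠ t in atTop, ∀ u, P.Settled u ((σ.state t).node u))
    {y : ℝ} (hy : y ∈ Set.Ico (0 : ℝ) 1) :
    ∀ᶠ t in atTop, ∀ v w, ∀ m ∈ (σ.state t).chan v w, ∀ I, m = .updateInterval I →
      y ∉ cover I := by
  have hrefers : ∀ᶠ t in atTop, ∀ x r, Refers σ y x r t → y ∈ P.sector r ∧ y ∈ P.R x := by
    rw [eventually_all]; intro x
    rw [eventually_all]; intro r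
    by_cases h : y ∈ P.sector r ∧ y ∈ P.R x
    · exact .of_forall fun _ _ => h
    · filter_upwards [eventually_not_refers hn hy h] with t ht h' using absurd h' ht
  have hcheck := eventually_chan (σ := σ) (Q := fun _ w m => ∀ J x, m = .checkInterval J x →
      y ∈ J.1 → y ∈ P.sector w ∧ y ∈ P.R x) <| by
    filter_upwards [hn, hrefers] with t hn hrefers
    rintro v w m h J x rfl hyJ
    rcases h.cases (hn v) with h | ⟨e, he, hw, h⟩ | ⟨_, _, -, h⟩ | ⟨_, _, _, -, -, -, h⟩ |
      ⟨_, _, -, ⟨h, -⟩ | ⟨J', h, -⟩⟩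
    · exact h.elim
    · cases h; exact hrefers _ _ ⟨e, he, hyJ, hw.symm⟩
    · cases h
    · cases h
    · cases h
    · cases h
  refine eventually_chan (Q := fun _ w m => ∀ I, m = .updateInterval I → y ∉ cover I) ?_
  filter_upwards [hn, hcheck] with t hn hcheck
  rintro v w m h I rfl hI
  rcases h.cases (hn v) with h | ⟨e, he, hw, h⟩ | ⟨x, J, hr, h⟩ | ⟨_, _, _, -, -, -, h⟩ |
    ⟨_, _, -, ⟨h, -⟩ | ⟨J', h, -⟩⟩
  · exact h.elim
  · cases h
  · cases h
    obtain ⟨h1, h2⟩ := ((hn v).exists_intervalSet_iff hy).1 hI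
    exact h2 (hcheck x v _ hr.mem J w rfl h1)
  · cases h
  · cases h
  · cases h

theorem eventually_not_forwardData
    (hn : ∀ᶠ t in atTop, ∀ u, P.Settled u ((σ.state t).node u)) (d : D) :
    ∀ᶠ t in atTop, ∀ v w, Msg.forwardData d ∉ (σ.state t).chan v w := by
  have hbound : ∀ w, P.hops (P.g d) w ≤ 1 + Fintype.card V := fun w => by
    unfold System.hops
    split_ifs
    · omega
    · exact Nat.add_le_add_left (Finset.card_le_univ _) 1
  -- Late forward-data messages for `d` arise only from earlier ones with a larger hop bound, since
  -- updates no longer cover `g d`. Each flush of the channels thus lowers the bound by one.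
  have key : ∀ k, ∀ᶠ t in atTop, ∀ v w, ∀ m ∈ (σ.state t).chan v w, m = .forwardData d →
      P.hops (P.g d) w + k ≤ 1 + Fintype.card V := by
    intro k
    induction k with
    | zero => exact .of_forall fun _ _ w _ _ _ => hbound w
    | succ k ih =>
      refine eventually_chan (Q := fun _ w m => m = .forwardData d →
        P.hops (P.g d) w + (k + 1) ≤ 1 + Fintype.card V) ?_
      filter_upwards [hn, ih, eventually_updateInterval hn (P.g_mem d)] with t hn ih hup
      rintro v w m h rfl
      rcases h.cases (hn v) with h | ⟨e, he, hw, h⟩ | ⟨x, J, hr, h⟩ | ⟨x, I, d', -, hr, hI, h⟩ |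
        ⟨x, d', hr, ⟨h, hlt⟩ | ⟨J', h, -⟩⟩
      · exact h.elim
      · cases h
      · cases h
      · cases h; exact absurd hI (hup x v _ hr.mem I rfl)
      · cases h
        have := ih x v _ hr.mem rfl
        omega
      · cases h
  -- One more round than the maximal value `1 + Fintype.card V` leaves no admissible hop bound.
  filter_upwards [key (2 + Fintype.card V)] with t ht v w hm
  have := ht v w _ hm rfl
  omega

theorem eventually_not_storeData
    (hn : ∀ᶠ t in atTop, ∀ u, P.Settled u ((σ.state t).node u)) (d : D) :
    ∀ᶠ t in atTop, ∀ v w J x, Msg.storeData d J x ∉ (σ.state t).chan v w := by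
  have := eventually_chan (σ := σ) (Q := fun _ _ m => ∀ J x, m ≠ .storeData d J x) <| by
    filter_upwards [hn, eventually_not_forwardData hn d] with t hn hfwd
    rintro v w m h J x rfl
    rcases h.cases (hn v) with h | ⟨e, he, hw, h⟩ | ⟨x, J, hr, h⟩ | ⟨x, I, d', -, hr, hI, h⟩ |
      ⟨x, d', hr, ⟨h, hlt⟩ | ⟨J', h, -⟩⟩
    · exact h.elim
    · cases h
    · cases h
    · cases h
    · cases h
    · cases h; exact hfwd _ _ hr.mem
  filter_upwards [this] with t ht v w J x hm using ht v w _ hm J x rfl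

/-- Eventually each present data element is stored at exactly the responsible node. -/
theorem eventually_stored_iff (hn : ∀ u, P.Settled u ((σ.state t₀).node u))
    (hv : P.ValidData (σ.state t₀)) {d : D} (hd : d ∈ (σ.state t₀).present)
    (hunique : ∀ u v : V, P.g d ∈ P.R u → P.g d ∈ P.R v → u = v) :
    ∀ᶠ t in atTop, ∀ u, d ∈ ((σ.state t).node u).stored ↔ P.g d ∈ P.R u := by
  have hn' : ∀ᶠ t in atTop, ∀ u, P.Settled u ((σ.state t).node u) :=
    eventually_atTop.2 ⟨t₀, fun t ht => settled_of_le hn ht⟩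
  have hrefers : ∀ᶠ t in atTop, ∀ x r, Refers σ (P.g d) x r t → P.g d ∈ P.R x := by
    rw [eventually_all]; intro x
    rw [eventually_all]; intro r
    by_cases h : P.g d ∈ P.sector r ∧ P.g d ∈ P.R x
    · exact .of_forall fun _ _ => h.2
    · filter_upwards [eventually_not_refers hn' (P.g_mem d) h] with t ht h' using absurd h' ht
  filter_upwards [eventually_ge_atTop t₀, hrefers, eventually_not_forwardData hn' d,
    eventually_not_storeData hn' d] with t ht hrefers hfwd hstore
  have hR : ∀ u, d ∈ ((σ.state t).node u).stored → P.g d ∈ P.R u := fun u hu => by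
    obtain ⟨e, he, hde⟩ := NodeState.mem_stored.1 hu
    exact hrefers u e.ref ⟨e, he, (validData_of_le hn hv ht).1 u e he d hde, rfl⟩
  refine fun u => ⟨hR u, fun hu => ?_⟩
  rw [← present_of_le hn hv ht] at hd
  -- The element is still present but no longer in transit, so some node `v` stores it; `v` is
  -- responsible, hence equal to `u`.
  rcases hd with ⟨v, hv⟩ | ⟨v, w, h | ⟨J, x, h⟩⟩
  · rwa [hunique u v hu (hR v hv)]
  · exact absurd h (hfwd v w)
  · exact absurd h (hstore v w J x)

end System.Computation

/-- The type `D` may be infinite; finiteness of the present data yields one time threshold for all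
of its elements. -/
theorem State.finite_present (s : State V D) : s.present.Finite := by
  refine Set.Finite.subset (s := (⋃ u, ((s.node u).stored : Set D)) ∪ ⋃ v, ⋃ w,
    {d | d ∈ (s.chan v w).filterMap fun m => match m with
      | .forwardData d => some d
      | .storeData d _ _ => some d
      | _ => none}) ?_ ?_
  · exact (Set.finite_iUnion fun u => Finset.finite_toSet _).union
      (Set.finite_iUnion fun v => Set.finite_iUnion fun w => List.finite_toSet _)
  · rintro d (⟨u, h⟩ | ⟨v, w, h | ⟨J, x, h⟩⟩)
    · exact .inl (Set.mem_iUnion.2 ⟨u, h⟩)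
    · exact .inr (Set.mem_iUnion₂.2 ⟨v, w, List.mem_filterMap.2 ⟨_, h, rfl⟩⟩)
    · exact .inr (Set.mem_iUnion₂.2 ⟨v, w, List.mem_filterMap.2 ⟨_, h, rfl⟩⟩)

end Convergence

end

end ConeDHT

theorem mainTheorem7 {V D : Type*} [Fintype V] (P : ConeDHT.System V D)
    (hunique : ∀ (d : D) (u v : V), P.g d ∈ P.R u → P.g d ∈ P.R v → u = v)
    (σ : P.Computation) (t₀ : ℕ)
    (hcone : P.IsCone (σ.state t₀)) (hdata : P.ValidData (σ.state t₀)) :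
    ∃ t₁, t₀ ≤ t₁ ∧ ∀ t, t₁ ≤ t → ∀ u : V,
      (((σ.state t).node u).stored : Set D) =
        {d | d ∈ (σ.state t₀).present ∧ P.g d ∈ P.R u} := by
  have hn := hcone.settled
  have hall : ∀ᶠ t in Filter.atTop, ∀ d ∈ (σ.state t₀).present, ∀ u,
      d ∈ ((σ.state t).node u).stored ↔ P.g d ∈ P.R u :=
    (Filter.eventually_all_finite (σ.state t₀).finite_present).2 fun d hd =>
      ConeDHT.System.Computation.eventually_stored_iff hn hdata hd (hunique d)
  obtain ⟨t₁, ht₁⟩ := Filter.eventually_atTop.1 hall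
  refine ⟨max t₀ t₁, le_max_left _ _, fun t ht u => ?_⟩
  ext d
  have hp : d ∈ ((σ.state t).node u).stored → d ∈ (σ.state t₀).present := fun h => by
    rw [← ConeDHT.System.Computation.present_of_le hn hdata ((le_max_left _ _).trans ht)]
    exact .inl ⟨u, h⟩
  exact ⟨fun h => ⟨hp h, (ht₁ t ((le_max_right _ _).trans ht) d (hp h) u).1 h⟩,
    fun h => (ht₁ t ((le_max_right _ _).trans ht) d h.1 u).2 h.2⟩
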